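/- Let $S=\mathbb{C}[x_0,x_1,x_2,x_3]$ and $\mathbb{P}^3=\operatorname{Proj} S$. Let $a\ge 1$ and $d\ge 2$ be integers, let $l_1,l_2\in S$ be linearly independent linear forms, and let $G_1\in S$ be a form of degree $a$ not divisible by $l_1$. Let $l\subset\mathbb{P}^3$ be the line $l_1=l_2=0$, and let $C_0\subset\mathbb{P}^3$ be the plane curve of degree $a+1$ with homogeneous ideal $(l_1,\,l_2G_1)$. Then for every smooth surface $X\subset\mathbb{P}^3$ of degree $d$ containing $C_0$ (in particular, for a general one), the sheaf $\mathcal{O}_X(-l-C_0)=\mathcal{O}_X(-l)\otimes\mathcal{O}_X(-C_0)$, i.e. the product in $\mathcal{O}_X$ of the ideal sheaves of $l$ and $C_0$, is $d$-regular in the sense of Castelnuovo–Mumford: $$H^i\bigl(X,\mathcal{O}_X(-l-C_0)\otimes\mathcal{O}_X(d-i)\bigr)=0\qquad\text{for all } i>0 .$$ -/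

import Mathlib

open MvPolynomial

noncomputable section

/-- The homogeneous coordinate ring `S = ℂ[x₀, x₁, x₂, x₃]` of projective three-space. -/
abbrev P3Ring : Type := MvPolynomial (Fin 4) ℂ

/-- The grading of `S` by degree. -/
abbrev p3Grading : ℕ → Submodule ℂ P3Ring := MvPolynomial.homogeneousSubmodule (Fin 4) ℂ

instance p3GradedAlgebra : GradedAlgebra p3Grading := MvPolynomial.gradedAlgebra

/-- The underlying Zariski space of `ℙ³ = Proj S`. -/
abbrev P3 : Type := ProjectiveSpectrum p3Grading

/-! ### The twisted sheaf `M~(n)` of a graded module `M` on `ℙ³` -/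

section GradedModule

variable {M : Type} [AddCommGroup M] [Module P3Ring M]

/-- The localization `M_p` of a module at a point `p` of `ℙ³`. -/
abbrev StalkAt (M : Type) [AddCommGroup M] [Module P3Ring M] (p : P3) : Type :=
  LocalizedModule p.asHomogeneousIdeal.toIdeal.primeCompl M

/-- A family `s` of elements `s p ∈ M_p`, for `p` in the open set `U`, is a section of `M~(n)`
if locally on `U` it is a fraction `m / f` with `m ∈ M` and `f ∈ S` homogeneous,
`deg m - deg f = n`, and `f` vanishing nowhere. -/
def IsTwistedSection (ℳ : ℕ → AddSubgroup M) (n : ℤ) (U : TopologicalSpace.Opens P3)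
    (s : ∀ p : U, StalkAt M p.1) : Prop :=
  ∀ p : U, ∃ V : TopologicalSpace.Opens P3, p.1 ∈ V ∧ ∃ hVU : V ≤ U,
    ∃ (k e : ℕ) (m : M) (f : P3Ring), (k : ℤ) = n + e ∧ m ∈ ℳ k ∧ f ∈ p3Grading e ∧
      ∀ q : V, ∃ hf : f ∈ q.1.asHomogeneousIdeal.toIdeal.primeCompl,
        s ⟨q.1, hVU q.2⟩ = LocalizedModule.mk m ⟨f, hf⟩

/-- The group `Γ(U, M~(n))` of sections over `U` of the `n`-th Serre twist of the quasi-coherent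
sheaf `M~` on `ℙ³` associated with a graded `S`-module `M`. -/
def twistedSections (ℳ : ℕ → AddSubgroup M) [SetLike.GradedSMul p3Grading ℳ] (n : ℤ)
    (U : TopologicalSpace.Opens P3) : AddSubgroup (∀ p : U, StalkAt M p.1) where
  carrier := {s | IsTwistedSection ℳ n U s}
  zero_mem' := by
    intro p
    obtain ⟨i, hi⟩ : ∃ i : Fin 4, (X i : P3Ring) ∉ p.1.asHomogeneousIdeal.toIdeal := by
      by_contra! h
      apply p.1.not_irrelevant_le
      intro g hg
      have h0 : constantCoeff g = 0 := by
        have h1 : GradedRing.proj p3Grading 0 g = 0 := hg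
        have h2 : homogeneousComponent 0 g = 0 := by
          rw [GradedRing.proj_apply] at h1
          rw [← MvPolynomial.decomposition.decompose'_apply]
          exact h1
        rw [homogeneousComponent_zero] at h2
        simpa [constantCoeff_eq] using h2
      have h3 : g ∈ idealOfVars (Fin 4) ℂ ^ 1 := by
        rw [mem_pow_idealOfVars_iff']
        intro x hx
        obtain rfl : x = 0 := (Finsupp.degree_eq_zero_iff x).1 (by omega)
        simpa [constantCoeff_eq] using h0
      rw [pow_one] at h3
      exact (Ideal.span_le.2 (by rintro _ ⟨i, rfl⟩; exact h i)) h3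
    refine ⟨U ⊓ ProjectiveSpectrum.basicOpen p3Grading (X i ^ n.natAbs), ⟨p.2, ?_⟩, inf_le_left,
      (n + n.natAbs).toNat, n.natAbs, 0, X i ^ n.natAbs, ?_, zero_mem _, ?_, ?_⟩
    · exact fun h => hi (p.1.isPrime.mem_of_pow_mem _ h)
    · omega
    · simpa using (isHomogeneous_X ℂ i).pow n.natAbs
    · intro q
      exact ⟨q.2.2, by simp⟩
  add_mem' := by
    intro s t hs ht p
    obtain ⟨V, hpV, hVU, k, e, m, f, hk, hm, hf, hs⟩ := hs p
    obtain ⟨W, hpW, hWU, k', e', m', f', hk', hm', hf', ht⟩ := ht p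
    refine ⟨V ⊓ W, ⟨hpV, hpW⟩, inf_le_left.trans hVU, e' + k, e + e', f' • m + f • m', f * f',
      by push_cast; omega, add_mem (SetLike.GradedSMul.smul_mem hf' hm) ?_,
      SetLike.GradedMul.mul_mem hf hf', ?_⟩
    · have h := SetLike.GradedSMul.smul_mem (A := p3Grading) (B := ℳ) hf hm'
      have : e +ᵥ k' = e' + k := by simp only [vadd_eq_add]; omega
      rwa [this] at h
    · intro q
      obtain ⟨h1, h2⟩ := hs ⟨q.1, q.2.1⟩
      obtain ⟨h3, h4⟩ := ht ⟨q.1, q.2.2⟩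
      refine ⟨mul_mem h1 h3, ?_⟩
      rw [Pi.add_apply, h2, h4, LocalizedModule.mk_add_mk]
      rfl
  neg_mem' := by
    intro s hs p
    obtain ⟨V, hpV, hVU, k, e, m, f, hk, hm, hf, hs⟩ := hs p
    refine ⟨V, hpV, hVU, k, e, -m, f, hk, neg_mem hm, hf, fun q => ?_⟩
    obtain ⟨h1, h2⟩ := hs q
    exact ⟨h1, by rw [Pi.neg_apply, h2, LocalizedModule.mk_neg]⟩

/-- Restriction of sections to a smaller open set. -/
def restrictSection (ℳ : ℕ → AddSubgroup M) [SetLike.GradedSMul p3Grading ℳ] (n : ℤ)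
    {U V : TopologicalSpace.Opens P3} (h : V ≤ U) :
    twistedSections ℳ n U →+ twistedSections ℳ n V where
  toFun s := ⟨fun p => s.1 ⟨p.1, h p.2⟩, by
    intro p
    obtain ⟨W, hpW, hWU, k, e, m, f, hk, hm, hf, hs⟩ := s.2 ⟨p.1, h p.2⟩
    exact ⟨W ⊓ V, ⟨hpW, p.2⟩, inf_le_right, k, e, m, f, hk, hm, hf,
      fun q => hs ⟨q.1, q.2.1⟩⟩⟩
  map_zero' := rfl
  map_add' _ _ := rfl

/-! ### Čech cohomology for the standard affine cover `D₊(x₀), …, D₊(x₃)` -/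

/-- The intersection `D₊(x_{i₀}) ∩ … ∩ D₊(x_{i_{p-1}})` for `i₀ < … < i_{p-1}`. -/
def cechOpen {p : ℕ} (I : Fin p ↪o Fin 4) : TopologicalSpace.Opens P3 :=
  ⨅ k : Fin p, ProjectiveSpectrum.basicOpen p3Grading (X (I k))

theorem cechOpen_le_face {p : ℕ} (I : Fin (p + 1) ↪o Fin 4) (k : Fin (p + 1)) :
    cechOpen I ≤ cechOpen ((Fin.succAboveOrderEmb k).trans I) :=
  le_iInf fun j => iInf_le _ (k.succAbove j)

/-- The group `Cᵖ` of Čech `p`-cochains with values in `M~(n)`. -/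
abbrev CechCochain (ℳ : ℕ → AddSubgroup M) [SetLike.GradedSMul p3Grading ℳ] (n : ℤ) (p : ℕ) :
    Type :=
  ∀ I : Fin (p + 1) ↪o Fin 4, twistedSections ℳ n (cechOpen I)

/-- The Čech differential `Cᵖ → Cᵖ⁺¹`,
`(d s)_{i₀ … i_{p+1}} = ∑ₖ (-1)ᵏ s_{i₀ … îₖ … i_{p+1}}` restricted to the intersection. -/
def cechD (ℳ : ℕ → AddSubgroup M) [SetLike.GradedSMul p3Grading ℳ] (n : ℤ) (p : ℕ) :
    CechCochain ℳ n p →+ CechCochain ℳ n (p + 1) where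
  toFun s := fun I => ∑ k : Fin (p + 2),
    (-1 : ℤ) ^ (k : ℕ) • restrictSection ℳ n (cechOpen_le_face I k)
      (s ((Fin.succAboveOrderEmb k).trans I))
  map_zero' := by funext I; simp
  map_add' s t := by funext I; simp [Finset.sum_add_distrib]

/-- The cohomology group `Hⁱ⁺¹(ℙ³, M~(n))` in positive degree `i + 1`: cocycles in `Cⁱ⁺¹` modulo
coboundaries of elements of `Cⁱ`. -/
abbrev PosCohomology (ℳ : ℕ → AddSubgroup M) [SetLike.GradedSMul p3Grading ℳ] (n : ℤ) (i : ℕ) :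
    Type :=
  (cechD ℳ n (i + 1)).ker ⧸ (cechD ℳ n i).range.addSubgroupOf (cechD ℳ n (i + 1)).ker

/-- Castelnuovo–Mumford regularity: the sheaf `ℱ = M~` is `m`-regular if
`Hʲ(ℙ³, ℱ(m - j)) = 0` for all `j > 0` (here `j = i + 1`). -/
def IsCMRegular (ℳ : ℕ → AddSubgroup M) [SetLike.GradedSMul p3Grading ℳ] (m : ℤ) : Prop :=
  ∀ i : ℕ, Subsingleton (PosCohomology ℳ (m - (i + 1)) i)

end GradedModule

/-! ### Surfaces, and the ideal sheaf of a sum of two curves on a surface -/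

/-- `F` is a form of degree `d` whose zero locus in `ℙ³` is a smooth surface (Jacobian
criterion). -/
def IsSmoothSurface (F : P3Ring) (d : ℕ) : Prop :=
  F.IsHomogeneous d ∧ ∀ x : Fin 4 → ℂ, x ≠ 0 → eval x F = 0 → ∃ i, eval x (pderiv i F) ≠ 0

/-- The coordinate ring `A_X = S / (F)` of the surface `X = {F = 0}`, as an `S`-module. -/
abbrev SurfaceRing (F : P3Ring) : Type := P3Ring ⧸ Ideal.span {F}

/-- For curves `D`, `E` on the surface `X = {F = 0}` with homogeneous ideals `I`, `J` in `S`: the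
product ideal `(I A_X) (J A_X)` of `A_X`. The associated sheaf is the product of the ideal
sheaves of `D` and `E` in `𝒪_X`; when `D` and `E` are effective Cartier divisors on `X` (always
so on a smooth surface, `D` and `E` having pure dimension one and no embedded points), it is
`𝒪_X(-D) ⊗ 𝒪_X(-E) = 𝒪_X(-D-E)`. -/
def divisorSumModule (F : P3Ring) (I J : Ideal P3Ring) : Submodule P3Ring (SurfaceRing F) :=
  (I.map (Ideal.Quotient.mk (Ideal.span {F})) *
    J.map (Ideal.Quotient.mk (Ideal.span {F}))).restrictScalars P3Ring

/-- The grading of a submodule of `A_X` by degree: the elements represented by forms of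
degree `k`. -/
def inducedGrading (F : P3Ring) (N : Submodule P3Ring (SurfaceRing F)) (k : ℕ) :
    AddSubgroup N where
  carrier := {m | ∃ g : P3Ring, g.IsHomogeneous k ∧ Ideal.Quotient.mk (Ideal.span {F}) g = m.1}
  zero_mem' := ⟨0, isHomogeneous_zero _ _ _, by simp⟩
  add_mem' := by
    rintro a b ⟨g, hg, hga⟩ ⟨h, hh, hhb⟩
    exact ⟨g + h, hg.add hh, by simp [hga, hhb]⟩
  neg_mem' := by
    rintro a ⟨g, hg, hga⟩
    exact ⟨-g, (homogeneousSubmodule (Fin 4) ℂ k).neg_mem hg, by simp [hga]⟩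

instance inducedGrading_gradedSMul (F : P3Ring) (N : Submodule P3Ring (SurfaceRing F)) :
    SetLike.GradedSMul p3Grading (inducedGrading F N) where
  smul_mem := by
    rintro i j f m hf ⟨g, hg, hgm⟩
    refine ⟨f * g, IsHomogeneous.mul hf hg, ?_⟩
    rw [map_mul, hgm]
    rfl

end

/-!
Let `I = (l₁, l₂)` and `J = (l₁, l₂ G₁)` be the ideals of the line and of the plane curve, and write
`F = l₁ A + l₂ G₁ B`. Since the surface is smooth of degree at least two, `l₁` does not divide `F`
(`not_dvd_of_isSmoothSurface`), which forces `d ≥ a + 1`.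

If `d ≥ a + 2`, then multiplication by `F` gives an exact sequence
`0 → I(-d) → I J → 𝒪_X(-l-C₀) → 0`: a multiple `F g` lies in `I J` only for `g ∈ I`, because `F` is
not in `I ^ 2` (`mem_of_mul_mem_mul_span_pair`, `notMem_or_notMem_of_isSmoothSurface`). Here `I` is
`1`-regular (`idealVanish_line`) and `I J = l₁ I + (l₂² G₁)` is `(a + 2)`-regular
(`idealVanish_mul`), and the long exact cohomology sequence gives the claim. If `d = a + 1`, then
`B` is a nonzero constant, `C₀` is a plane section of the surface, and multiplication by `l₁` gives
`0 → S(-d-1) → I(-1) → 𝒪_X(-l-C₀) → 0` (`idealVanish_of_planeSection`). The regularity of `I` and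
of `I J` comes in the same way from sequences whose outer terms are twists of `S` and of `S / (l₁)`.

All modules that occur are images of an ideal `K` of `S` in `S / (F)`, possibly with `F = 0`
(`idealModule`). Exact sequences of such modules induce exact sequences of Čech cochains because
a section over an intersection of the standard affine open sets is a single global fraction
(`exists_eq_fraction`). The two needed pieces of the long exact sequence are
`GradedSES.cechVanish_right` and `GradedSES.cechVanish_middle`. The vanishing for the twists of the
structure sheaf (`cechVanish_ringGrading`) is computed on Laurent polynomials: a cochain is split
according to a coordinate in which the exponent is nonnegative, and each part is contracted by the
cone over the corresponding vertex (`orderedD_orderedCone`).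
-/

noncomputable section

/-! ### The combinatorial Čech complex of a simplex -/

section Simplex

variable {A : Type*} [AddCommGroup A]

/-- The sign `(-1)^r`, where `r` is the position of `i` in the increasing enumeration of
`T ∪ {i}`. -/
def simplexSign (i : Fin 4) (T : Finset (Fin 4)) : ℤ := (-1) ^ (T.filter (· < i)).card

theorem simplexSign_mul_self (i : Fin 4) (T : Finset (Fin 4)) :
    simplexSign i T * simplexSign i T = 1 := by
  simp [simplexSign, ← mul_pow]

theorem simplexSign_erase_self (i : Fin 4) (T : Finset (Fin 4)) :
    simplexSign i (T.erase i) = simplexSign i T := by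
  unfold simplexSign
  congr 2
  ext k
  simp only [Finset.mem_filter, Finset.mem_erase]
  exact ⟨fun h => ⟨h.1.2, h.2⟩, fun h => ⟨⟨h.2.ne, h.1⟩, h.2⟩⟩

theorem simplexSign_insert_self (i : Fin 4) (T : Finset (Fin 4)) :
    simplexSign i (insert i T) = simplexSign i T := by
  rw [← simplexSign_erase_self, Finset.erase_insert_eq_erase, simplexSign_erase_self]

theorem simplexSign_erase_mul : ∀ (i j : Fin 4) (T : Finset (Fin 4)), i ∈ T → j ∈ T → i ≠ j →
    simplexSign i T * simplexSign j (T.erase i) =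
      -(simplexSign j T * simplexSign i (T.erase j)) := by
  unfold simplexSign
  decide

theorem simplexSign_insert_mul : ∀ (i j : Fin 4) (T : Finset (Fin 4)), i ∈ T → j ∉ T →
    simplexSign j T * simplexSign i (insert j T) =
      -(simplexSign i T * simplexSign j (T.erase i)) := by
  unfold simplexSign
  decide

/-- The simplicial coboundary on functions defined on all subsets of the vertex set. -/
def simplexD (c : Finset (Fin 4) → A) (T : Finset (Fin 4)) : A :=
  ∑ i ∈ T, simplexSign i T • c (T.erase i)

theorem simplexD_simplexD (c : Finset (Fin 4) → A) (T : Finset (Fin 4)) :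
    simplexD (simplexD c) T = 0 := by
  simp only [simplexD, Finset.smul_sum, smul_smul]
  rw [Finset.sum_sigma']
  refine Finset.sum_involution (fun x _ => ⟨x.2, x.1⟩) ?_ ?_ ?_ ?_
  · rintro ⟨i, j⟩ h
    simp only [Finset.mem_sigma, Finset.mem_erase] at h
    rw [simplexSign_erase_mul i j T h.1 h.2.2 (Ne.symm h.2.1), Finset.erase_right_comm]
    simp
  · rintro ⟨i, j⟩ h _ heq
    simp only [Finset.mem_sigma, Finset.mem_erase] at h
    simp only [Sigma.mk.injEq] at heq
    exact h.2.1 heq.1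
  · rintro ⟨i, j⟩ h
    simp only [Finset.mem_sigma, Finset.mem_erase] at h ⊢
    exact ⟨h.2.2, Ne.symm h.2.1, h.1⟩
  · rintro ⟨i, j⟩ _
    rfl

/-- The cone construction with apex `j`, a contracting homotopy for `simplexD`. -/
def simplexCone (j : Fin 4) (c : Finset (Fin 4) → A) (T : Finset (Fin 4)) : A :=
  if j ∈ T then 0 else simplexSign j T • c (insert j T)

theorem simplexD_simplexCone_add (j : Fin 4) (c : Finset (Fin 4) → A) (T : Finset (Fin 4)) :
    simplexD (simplexCone j c) T + simplexCone j (simplexD c) T = c T := by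
  by_cases hj : j ∈ T
  · rw [simplexCone, if_pos hj, add_zero, simplexD, Finset.sum_eq_single_of_mem j hj]
    · rw [simplexCone, if_neg (Finset.notMem_erase j T), simplexSign_erase_self,
        Finset.insert_erase hj, smul_smul, simplexSign_mul_self, one_smul]
    · intro i _ hij
      rw [simplexCone, if_pos (Finset.mem_erase.2 ⟨hij.symm, hj⟩), smul_zero]
  · rw [simplexCone, if_neg hj, simplexD, simplexD, Finset.sum_insert hj, smul_add,
      simplexSign_insert_self, Finset.erase_insert hj, smul_smul, simplexSign_mul_self, one_smul,
      add_left_comm, Finset.smul_sum, ← Finset.sum_add_distrib, Finset.sum_eq_zero, add_zero]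
    intro i hi
    have hij : i ≠ j := by rintro rfl; exact hj hi
    rw [simplexCone, if_neg (fun h => hj (Finset.mem_of_mem_erase h)), smul_smul, smul_smul,
      simplexSign_insert_mul i j T hi hj, Finset.erase_insert_of_ne hij.symm, neg_smul,
      add_neg_cancel]

/-- The vertex set of an ordered simplex. -/
def simplexVertices {p : ℕ} (I : Fin p ↪o Fin 4) : Finset (Fin 4) :=
  Finset.univ.map I.toEmbedding

theorem card_simplexVertices {p : ℕ} (I : Fin p ↪o Fin 4) : (simplexVertices I).card = p := by
  simp [simplexVertices]

theorem mem_simplexVertices {p : ℕ} (I : Fin p ↪o Fin 4) (i : Fin 4) :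
    i ∈ simplexVertices I ↔ ∃ k, I k = i := by
  simp [simplexVertices]

theorem simplexVertices_orderEmbOfFin {p : ℕ} (T : Finset (Fin 4)) (h : T.card = p) :
    simplexVertices (T.orderEmbOfFin h) = T := by
  ext i
  rw [mem_simplexVertices, ← Finset.mem_coe (s := T), ← Finset.range_orderEmbOfFin T h]
  rfl

/-- The extension by zero of a cochain on ordered simplices to all subsets. -/
def extendCochain {p : ℕ} (c : (Fin p ↪o Fin 4) → A) (T : Finset (Fin 4)) : A :=
  if h : T.card = p then c (T.orderEmbOfFin h) else 0

theorem extendCochain_simplexVertices {p : ℕ} (c : (Fin p ↪o Fin 4) → A) (I : Fin p ↪o Fin 4) :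
    extendCochain c (simplexVertices I) = c I := by
  rw [extendCochain, dif_pos (card_simplexVertices I)]
  congr 1
  symm
  apply Finset.orderEmbOfFin_unique'
  intro k
  rw [mem_simplexVertices]
  exact ⟨k, rfl⟩

/-- The coboundary of a cochain on ordered simplices. -/
def orderedD {p : ℕ} (c : (Fin p ↪o Fin 4) → A) (I : Fin (p + 1) ↪o Fin 4) : A :=
  ∑ k : Fin (p + 1), (-1 : ℤ) ^ (k : ℕ) • c ((Fin.succAboveOrderEmb k).trans I)

theorem simplexVertices_erase {p : ℕ} (I : Fin (p + 1) ↪o Fin 4) (k : Fin (p + 1)) :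
    (simplexVertices I).erase (I k) = simplexVertices ((Fin.succAboveOrderEmb k).trans I) := by
  ext i
  simp only [Finset.mem_erase, mem_simplexVertices]
  constructor
  · rintro ⟨h, m, rfl⟩
    obtain ⟨l, hl⟩ := Fin.exists_succAbove_eq (x := m) (y := k) (fun h' => h (by rw [h']))
    exact ⟨l, by rw [← hl]; rfl⟩
  · rintro ⟨l, rfl⟩
    exact ⟨fun h => Fin.succAbove_ne k l (I.injective h), _, rfl⟩

theorem simplexSign_simplexVertices {p : ℕ} (I : Fin (p + 1) ↪o Fin 4) (k : Fin (p + 1)) :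
    simplexSign (I k) (simplexVertices I) = (-1) ^ (k : ℕ) := by
  have : (simplexVertices I).filter (· < I k) = (Finset.Iio k).map I.toEmbedding := by
    ext i
    simp only [Finset.mem_filter, mem_simplexVertices, Finset.mem_map, Finset.mem_Iio]
    constructor
    · rintro ⟨⟨m, rfl⟩, h⟩
      exact ⟨m, I.lt_iff_lt.1 h, rfl⟩
    · rintro ⟨m, h, rfl⟩
      exact ⟨⟨m, rfl⟩, I.lt_iff_lt.2 h⟩
  rw [simplexSign, this, Finset.card_map, Fin.card_Iio]

theorem simplexD_extendCochain {p : ℕ} (c : (Fin p ↪o Fin 4) → A) (I : Fin (p + 1) ↪o Fin 4) :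
    simplexD (extendCochain c) (simplexVertices I) = orderedD c I := by
  rw [simplexD, orderedD]
  conv_lhs => rw [simplexVertices, Finset.sum_map]
  refine Finset.sum_congr rfl fun k _ => ?_
  change simplexSign (I k) (simplexVertices I) •
    extendCochain c ((simplexVertices I).erase (I k)) = _
  rw [simplexSign_simplexVertices, simplexVertices_erase, extendCochain_simplexVertices]

theorem simplexD_congr {p : ℕ} {c c' : Finset (Fin 4) → A}
    (h : ∀ T : Finset (Fin 4), T.card = p → c T = c' T) {T : Finset (Fin 4)}
    (hT : T.card = p + 1) : simplexD c T = simplexD c' T := by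
  refine Finset.sum_congr rfl fun i hi => ?_
  rw [h _ (by rw [Finset.card_erase_of_mem hi, hT]; rfl)]

theorem extendCochain_orderedD {p : ℕ} (c : (Fin p ↪o Fin 4) → A) (T : Finset (Fin 4))
    (hT : T.card = p + 1) : extendCochain (orderedD c) T = simplexD (extendCochain c) T := by
  rw [extendCochain, dif_pos hT, ← simplexD_extendCochain, simplexVertices_orderEmbOfFin]

theorem orderedD_orderedD {p : ℕ} (c : (Fin p ↪o Fin 4) → A) (I : Fin (p + 1 + 1) ↪o Fin 4) :
    orderedD (orderedD c) I = 0 := by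
  rw [← simplexD_extendCochain,
    simplexD_congr (extendCochain_orderedD c) (card_simplexVertices I), simplexD_simplexD]

/-- The cone construction on ordered cochains. -/
def orderedCone (j : Fin 4) {p : ℕ} (c : (Fin (p + 1) ↪o Fin 4) → A) (I : Fin p ↪o Fin 4) : A :=
  simplexCone j (extendCochain c) (simplexVertices I)

theorem orderedD_orderedCone (j : Fin 4) {p : ℕ} (c : (Fin (p + 1) ↪o Fin 4) → A)
    (hc : ∀ I, orderedD c I = 0) (I : Fin (p + 1) ↪o Fin 4) :
    orderedD (orderedCone j c) I = c I := by
  have h1 : simplexCone j (simplexD (extendCochain c)) (simplexVertices I) = 0 := by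
    rw [simplexCone]
    split_ifs with h
    · rfl
    · rw [← extendCochain_orderedD, extendCochain]
      · split_ifs <;> simp [hc]
      · rw [Finset.card_insert_of_notMem h, card_simplexVertices]
  have h2 := simplexD_simplexCone_add j (extendCochain c) (simplexVertices I)
  rw [h1, add_zero, extendCochain_simplexVertices] at h2
  rw [← h2, ← simplexD_extendCochain]
  refine simplexD_congr (fun T hT => ?_) (card_simplexVertices I)
  rw [extendCochain, dif_pos hT, orderedCone, simplexVertices_orderEmbOfFin]

/-- A value of the cone over `c` is, up to sign, a value of `c` at a simplex with the apex
adjoined. -/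
theorem orderedCone_eq (j : Fin 4) {p : ℕ} (c : (Fin (p + 1) ↪o Fin 4) → A) (I : Fin p ↪o Fin 4) :
    orderedCone j c I = 0 ∨ ∃ I' : Fin (p + 1) ↪o Fin 4, ∃ z : ℤ,
      (∀ i ∈ simplexVertices I', i = j ∨ i ∈ simplexVertices I) ∧ orderedCone j c I = z • c I' := by
  rw [orderedCone, simplexCone]
  split_ifs with h
  · exact Or.inl rfl
  · have hc : (insert j (simplexVertices I)).card = p + 1 := by
      rw [Finset.card_insert_of_notMem h, card_simplexVertices]
    refine Or.inr ⟨(insert j (simplexVertices I)).orderEmbOfFin hc,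
      simplexSign j (simplexVertices I), ?_, ?_⟩
    · intro i hi
      rw [simplexVertices_orderEmbOfFin] at hi
      exact Finset.mem_insert.1 hi
    · rw [extendCochain, dif_pos hc]

end Simplex

/-! ### Sections over principal open sets are global fractions -/

section HomogeneousComponents

theorem homogeneousComponent_of_mem_self {k : ℕ} {f : P3Ring} (hf : f ∈ p3Grading k) :
    homogeneousComponent k f = f := by
  rw [homogeneousComponent_of_mem hf, if_pos rfl]

theorem homogeneousComponent_mul_of_mem {e : ℕ} {h : P3Ring} (hh : h ∈ p3Grading e) (c : P3Ring)
    (k : ℕ) : homogeneousComponent k (c * h) =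
      if e ≤ k then homogeneousComponent (k - e) c * h else 0 := by
  have h1 : ∀ (j : ℕ) (x : P3Ring), homogeneousComponent j x =
      (DirectSum.decompose p3Grading x j : P3Ring) := fun j x =>
    (MvPolynomial.decomposition.decompose'_apply x j).symm
  split_ifs with hek
  · rw [h1, h1, DirectSum.coe_decompose_mul_of_right_mem_of_le _ hh hek]
  · rw [h1, DirectSum.coe_decompose_mul_of_right_mem_of_not_le _ hh hek]

end HomogeneousComponents

section Fractions

variable {M : Type} [AddCommGroup M] [Module P3Ring M]

/-- The subgroups `ℳ k` are independent: a finite sum of elements of distinct degrees vanishes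
only if every summand does. -/
def GradedIndependent (ℳ : ℕ → AddSubgroup M) : Prop :=
  ∀ (s : Finset ℕ) (m : ℕ → M), (∀ i, m i ∈ ℳ i) → ∑ i ∈ s, m i = 0 → ∀ i ∈ s, m i = 0

theorem localizedModule_mk_eq_zero_iff {S : Submonoid P3Ring} (m : M) (s : S) :
    LocalizedModule.mk m s = 0 ↔ ∃ u ∈ S, u • m = 0 := by
  rw [← LocalizedModule.zero_mk (1 : S), LocalizedModule.mk_eq]
  constructor
  · rintro ⟨u, hu⟩
    refine ⟨u, u.2, ?_⟩
    simpa [Submonoid.smul_def] using hu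
  · rintro ⟨u, hu, h⟩
    refine ⟨⟨u, hu⟩, ?_⟩
    simpa [Submonoid.smul_def] using h

variable {ℳ : ℕ → AddSubgroup M} [SetLike.GradedSMul p3Grading ℳ]

theorem smul_mem_grading {i k : ℕ} {f : P3Ring} {m : M} (hf : f ∈ p3Grading i) (hm : m ∈ ℳ k) :
    f • m ∈ ℳ (i + k) := by
  simpa using SetLike.GradedSMul.smul_mem (A := p3Grading) (B := ℳ) hf hm

/-- If a polynomial annihilates a homogeneous element, then so do all its homogeneous
components. -/
theorem homogeneousComponent_smul_eq_zero (hℳ : GradedIndependent ℳ) {k : ℕ} {m : M}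
    (hm : m ∈ ℳ k) {u : P3Ring} (hu : u • m = 0) (i : ℕ) :
    homogeneousComponent i u • m = 0 := by
  by_cases hi : i ∈ Finset.range (u.totalDegree + 1)
  · have h := hℳ ((Finset.range (u.totalDegree + 1)).map (addRightEmbedding k))
      (fun j => if k ≤ j then homogeneousComponent (j - k) u • m else 0) ?_ ?_ (i + k) ?_
    · simpa using h
    · intro j
      split_ifs with hj
      · have := smul_mem_grading (ℳ := ℳ) (homogeneousComponent_mem (j - k) u) hm
        rwa [Nat.sub_add_cancel hj] at this
      · exact zero_mem _
    · rw [Finset.sum_map]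
      simp only [addRightEmbedding_apply, Nat.le_add_left, if_true, Nat.add_sub_cancel]
      rw [← Finset.sum_smul, sum_homogeneousComponent, hu]
    · simpa using hi
  · rw [homogeneousComponent_eq_zero _ _ (by simpa using hi), zero_smul]

theorem exists_homogeneousComponent_notMem {I : Ideal P3Ring} {u : P3Ring} (hu : u ∉ I) :
    ∃ i, homogeneousComponent i u ∉ I := by
  by_contra! h
  apply hu
  rw [← sum_homogeneousComponent u]
  exact I.sum_mem fun i _ => h i

/-- A form of positive degree that vanishes at every common zero in `ℙ³` of a set of forms lies in
the radical of the ideal generated by them. -/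
theorem mem_radical_span {δ : ℕ} (hδ : 0 < δ) {f : P3Ring} (hf : f ∈ p3Grading δ)
    (s : Set P3Ring) (hs : ∀ g ∈ s, ∃ i, g ∈ p3Grading i)
    (h : ∀ q : P3, f ∉ q.asHomogeneousIdeal.toIdeal → ∃ g ∈ s, g ∉ q.asHomogeneousIdeal.toIdeal) :
    f ∈ (Ideal.span s).radical := by
  have hhom : (Ideal.span s).IsHomogeneous p3Grading := Ideal.homogeneous_span _ _ hs
  rw [hhom.radical_eq, Submodule.mem_sInf]
  rintro J ⟨hJ, hsJ, hJp⟩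
  by_contra hfJ
  have hrel : ¬ HomogeneousIdeal.irrelevant p3Grading ≤ ⟨J, hJ⟩ := by
    intro hle
    apply hfJ
    refine hle ?_
    rw [HomogeneousIdeal.mem_irrelevant_iff, GradedRing.proj_apply,
      DirectSum.decompose_of_mem_ne _ hf (by omega)]
  obtain ⟨g, hg, hgJ⟩ := h ⟨⟨J, hJ⟩, hJp, hrel⟩ hfJ
  exact hgJ (hsJ (Ideal.subset_span hg))

/-- A homogeneous element whose germs vanish on the locus where `f ≠ 0` is killed by a power of
`f`. -/
theorem exists_pow_smul_eq_zero (hℳ : GradedIndependent ℳ) {k : ℕ} {m : M} (hm : m ∈ ℳ k)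
    {δ : ℕ} (hδ : 0 < δ) {f : P3Ring} (hf : f ∈ p3Grading δ)
    (h : ∀ q : P3, f ∉ q.asHomogeneousIdeal.toIdeal →
      ∃ u, u ∉ q.asHomogeneousIdeal.toIdeal ∧ u • m = 0) :
    ∃ K : ℕ, f ^ K • m = 0 := by
  obtain ⟨K, hK⟩ := mem_radical_span hδ hf {g | (∃ i, g ∈ p3Grading i) ∧ g • m = 0}
    (fun g hg => hg.1) (fun q hq => by
      obtain ⟨u, hu, hum⟩ := h q hq
      obtain ⟨i, hi⟩ := exists_homogeneousComponent_notMem hu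
      exact ⟨_, ⟨⟨i, homogeneousComponent_mem i u⟩,
        homogeneousComponent_smul_eq_zero hℳ hm hum i⟩, hi⟩)
  refine ⟨K, ?_⟩
  have hle : Ideal.span {g : P3Ring | (∃ i, g ∈ p3Grading i) ∧ g • m = 0} ≤
      LinearMap.ker (LinearMap.toSpanSingleton P3Ring M m) :=
    Ideal.span_le.2 fun g hg => hg.2
  exact hle hK

/-- The section `m / f` of `M~(n)` over an open set on which `f` does not vanish. -/
def fractionSection (ℳ : ℕ → AddSubgroup M) [SetLike.GradedSMul p3Grading ℳ] {n : ℤ}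
    (U : TopologicalSpace.Opens P3) {k e : ℕ} (hk : (k : ℤ) = n + e) (m : M) (hm : m ∈ ℳ k)
    (f : P3Ring) (hf : f ∈ p3Grading e) (hU : ∀ q ∈ U, f ∉ q.asHomogeneousIdeal.toIdeal) :
    twistedSections ℳ n U :=
  ⟨fun p => LocalizedModule.mk m ⟨f, hU p.1 p.2⟩,
    fun p => ⟨U, p.2, le_rfl, k, e, m, f, hk, hm, hf, fun q => ⟨hU q.1 q.2, rfl⟩⟩⟩

/-- Every section of `M~(n)` over the principal open set `f ≠ 0` is a single fraction `m / f ^ N`,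
with `m` of any sufficiently large degree that is compatible with `n`. -/
theorem exists_eq_fraction (hℳ : GradedIndependent ℳ) {n : ℤ} {U : TopologicalSpace.Opens P3}
    {δ : ℕ} (hδ : 0 < δ) {f : P3Ring} (hf : f ∈ p3Grading δ)
    (hU : ∀ q, q ∈ U ↔ f ∉ q.asHomogeneousIdeal.toIdeal) (s : twistedSections ℳ n U) (b : ℕ) :
    ∃ (N k : ℕ) (m : M), b ≤ k ∧ (k : ℤ) = n + (N * δ : ℕ) ∧ m ∈ ℳ k ∧
      ∀ (q : U) (h : f ^ N ∈ q.1.asHomogeneousIdeal.toIdeal.primeCompl),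
        s.1 q = LocalizedModule.mk m ⟨f ^ N, h⟩ := by
  classical
  -- Around each point the section is a fraction over the principal open set of its denominator;
  -- the factor `f` makes the degree of the denominator positive.
  have hloc : ∀ p : U, ∃ (k e : ℕ) (m : M) (g : P3Ring), 0 < e ∧ (k : ℤ) = n + e ∧ m ∈ ℳ k ∧
      g ∈ p3Grading e ∧ g ∉ p.1.asHomogeneousIdeal.toIdeal ∧
      ∀ (q : P3) (hq : g ∉ q.asHomogeneousIdeal.toIdeal), ∃ h : q ∈ U,
        s.1 ⟨q, h⟩ = LocalizedModule.mk m ⟨g, hq⟩ := by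
    intro p
    obtain ⟨V, hpV, hVU, k, e, m, g, hk, hm, hg, hs⟩ := s.2 p
    obtain ⟨_, ⟨r, rfl⟩, hpr, hrV⟩ :=
      (ProjectiveSpectrum.isTopologicalBasis_basic_opens p3Grading).exists_subset_of_mem_open
        hpV V.isOpen
    obtain ⟨i, hi⟩ := exists_homogeneousComponent_notMem (I := p.1.asHomogeneousIdeal.toIdeal) hpr
    have hr : f * homogeneousComponent i r ∈ p3Grading (δ + i) :=
      SetLike.GradedMul.mul_mem hf (homogeneousComponent_mem i r)
    refine ⟨δ + i + k, δ + i + e, (f * homogeneousComponent i r) • m,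
      (f * homogeneousComponent i r) * g, by omega, by push_cast; omega,
      smul_mem_grading hr hm, SetLike.GradedMul.mul_mem hr hg, ?_, ?_⟩
    · obtain ⟨h1, -⟩ := hs ⟨p.1, hpV⟩
      exact fun h => (p.1.isPrime.mem_or_mem h).elim
        (fun h => (p.1.isPrime.mem_or_mem h).elim ((hU _).1 p.2) hi) h1
    · intro q hq
      have hq0 : f * homogeneousComponent i r ∉ q.asHomogeneousIdeal.toIdeal :=
        fun h => hq (Ideal.mul_mem_right _ _ h)
      have hqV : q ∈ V := hrV (fun h : r ∈ q.asHomogeneousIdeal => hq0 <| by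
        have := q.asHomogeneousIdeal.isHomogeneous i h
        exact Ideal.mul_mem_left _ _ (by rwa [← MvPolynomial.decomposition.decompose'_apply]))
      obtain ⟨h1, h2⟩ := hs ⟨q, hqV⟩
      refine ⟨hVU hqV, ?_⟩
      rw [h2]
      exact (LocalizedModule.mk_cancel_common_left ⟨_, hq0⟩ ⟨g, h1⟩ m).symm
  choose k e m g he hk hm hg hgp hs using hloc
  -- On overlaps the fractions agree after multiplication by a power of the denominators.
  have hover : ∀ p q : U, ∃ K : ℕ, (g p * g q) ^ K • (g q • m p - g p • m q) = 0 := by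
    intro p q
    refine exists_pow_smul_eq_zero hℳ (k := e q + k p) (sub_mem (smul_mem_grading (hg q) (hm p))
      ?_) (Nat.add_pos_left (he p) (e q)) (SetLike.GradedMul.mul_mem (hg p) (hg q)) ?_
    · have := smul_mem_grading (hg p) (hm q)
      rwa [show e p + k q = e q + k p by have := hk p; have := hk q; omega] at this
    · intro r hr
      have h1 : g p ∉ r.asHomogeneousIdeal.toIdeal := fun h => hr (Ideal.mul_mem_right _ _ h)
      have h2 : g q ∉ r.asHomogeneousIdeal.toIdeal := fun h => hr (Ideal.mul_mem_left _ _ h)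
      obtain ⟨_, h3⟩ := hs p r h1
      obtain ⟨_, h4⟩ := hs q r h2
      obtain ⟨u, hu⟩ := LocalizedModule.mk_eq.1 (h3.symm.trans h4)
      refine ⟨u, u.2, ?_⟩
      rw [smul_sub, sub_eq_zero]
      exact hu
  choose K hK using hover
  -- Finitely many of these open sets cover `U`.
  obtain ⟨t, ht⟩ : ∃ t : Finset U, ∀ q ∈ U, ∃ p ∈ t, g p ∉ q.asHomogeneousIdeal.toIdeal := by
    obtain ⟨N, hN⟩ := mem_radical_span hδ hf (Set.range g) (by rintro _ ⟨p, rfl⟩; exact ⟨_, hg p⟩)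
      (fun q hq => ⟨_, ⟨⟨q, (hU q).2 hq⟩, rfl⟩, hgp ⟨q, (hU q).2 hq⟩⟩)
    obtain ⟨c, hc⟩ := Finsupp.mem_span_range_iff_exists_finsupp.1 hN
    refine ⟨c.support, fun q hq => ?_⟩
    by_contra! hall
    refine (hU q).1 hq (q.isPrime.mem_of_pow_mem N ?_)
    rw [← hc]
    exact Ideal.sum_mem _ fun p hp => Ideal.mul_mem_left _ _ (hall p hp)
  obtain ⟨L, hL⟩ : ∃ L, ∀ p ∈ t, ∀ q ∈ t, K p q ≤ L :=
    ⟨(t ×ˢ t).sup (fun x => K x.1 x.2), fun p hp q hq =>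
      Finset.le_sup (f := fun x : U × U => K x.1 x.2) (b := (p, q)) (Finset.mk_mem_product hp hq)⟩
  obtain ⟨N₀, hN₀⟩ := mem_radical_span hδ hf ((fun p => g p ^ (L + 1)) '' (t : Set U))
    (by rintro _ ⟨p, -, rfl⟩; exact ⟨_, SetLike.pow_mem_graded (L + 1) (hg p)⟩)
    (fun q hq => by
      obtain ⟨p, hp, hpq⟩ := ht q ((hU q).2 hq)
      exact ⟨_, ⟨p, hp, rfl⟩, fun h => hpq (q.isPrime.mem_of_pow_mem _ h)⟩)
  obtain ⟨N, hN⟩ : ∃ N, N = N₀ + n.natAbs + b := ⟨_, rfl⟩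
  have hNspan : f ^ N ∈ Ideal.span ((fun p => g p ^ (L + 1)) '' (t : Set U)) := by
    rw [hN, add_assoc, pow_add]
    exact Ideal.mul_mem_right _ _ hN₀
  obtain ⟨c, hc⟩ : ∃ c : U → P3Ring, ∑ p ∈ t, c p * g p ^ (L + 1) = f ^ N := by
    obtain ⟨c, hc⟩ := (Submodule.mem_span_image_finset_iff_exists_fun' P3Ring).1 hNspan
    exact ⟨c, hc⟩
  have hfN : f ^ N ∈ p3Grading (N * δ) := by
    simpa using SetLike.pow_mem_graded N hf
  set c' : U → P3Ring := fun p => if (L + 1) * e p ≤ N * δ then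
    homogeneousComponent (N * δ - (L + 1) * e p) (c p) else 0 with hc'
  have hcc : ∑ p ∈ t, c' p * g p ^ (L + 1) = f ^ N := by
    have hgL : ∀ p, g p ^ (L + 1) ∈ p3Grading ((L + 1) * e p) := fun p => by
      simpa using SetLike.pow_mem_graded (L + 1) (hg p)
    rw [← homogeneousComponent_of_mem_self hfN, ← hc, map_sum]
    refine Finset.sum_congr rfl fun p _ => ?_
    rw [homogeneousComponent_mul_of_mem (hgL p), hc', ite_mul, zero_mul]
  have hNδ : (n.natAbs + b : ℕ) ≤ N * δ := by
    refine le_trans ?_ (Nat.le_mul_of_pos_right _ hδ)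
    omega
  refine ⟨N, (n + (N * δ : ℕ)).toNat, ∑ p ∈ t, (c' p * g p ^ L) • m p, by omega, by omega,
    sum_mem fun p _ => ?_, ?_⟩
  · by_cases h : (L + 1) * e p ≤ N * δ
    · have h1 : c' p * g p ^ L ∈ p3Grading (N * δ - (L + 1) * e p + L * e p) := by
        refine SetLike.GradedMul.mul_mem ?_ (by simpa using SetLike.pow_mem_graded L (hg p))
        rw [hc']
        simp only [if_pos h]
        exact homogeneousComponent_mem _ _
      have h2 := smul_mem_grading h1 (hm p)
      have h3 : N * δ - (L + 1) * e p + L * e p + k p = (n + (N * δ : ℕ)).toNat := by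
        have := hk p
        have h4 : (L + 1) * e p = L * e p + e p := by ring
        rw [h4] at h ⊢
        omega
      rwa [h3] at h2
    · have : c' p = 0 := by rw [hc']; simp only [if_neg h]
      rw [this, zero_mul, zero_smul]
      exact zero_mem _
  · intro q hq
    obtain ⟨p, hp, hpq⟩ := ht q.1 q.2
    obtain ⟨_, h1⟩ := hs p q.1 hpq
    rw [h1, LocalizedModule.mk_eq]
    refine ⟨⟨g p ^ L, fun h => hpq (q.1.isPrime.mem_of_pow_mem _ h)⟩, ?_⟩
    simp only [Submonoid.smul_def]
    rw [← hcc, Finset.sum_smul, Finset.smul_sum, Finset.smul_sum, Finset.smul_sum]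
    refine Finset.sum_congr rfl fun p' hp' => ?_
    have h2 : (g p' * g p) ^ L • (g p • m p' - g p' • m p) = 0 := by
      obtain ⟨r, hr⟩ := Nat.exists_eq_add_of_le (hL p' hp' p hp)
      rw [hr, pow_add, mul_comm, mul_smul, hK, smul_zero]
    rw [smul_sub, sub_eq_zero, smul_smul, smul_smul] at h2
    calc g p ^ L • (c' p' * g p' ^ (L + 1)) • m p
        = c' p' • ((g p' * g p) ^ L * g p') • m p := by simp only [smul_smul]; congr 1; ring
      _ = g p ^ L • g p • (c' p' * g p' ^ L) • m p' := by
          rw [← h2]; simp only [smul_smul]; congr 1; ring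

end Fractions

/-! ### Čech cochains and exact sequences of graded modules -/

section CechComplex

/-- The form `x_{i₀} ⋯ x_{i_{p-1}}` whose nonvanishing locus is `cechOpen I`. -/
def cechForm {p : ℕ} (I : Fin p ↪o Fin 4) : P3Ring := ∏ k, X (I k)

theorem cechForm_mem {p : ℕ} (I : Fin p ↪o Fin 4) : cechForm I ∈ p3Grading p := by
  have h := IsHomogeneous.prod Finset.univ (fun k => (X (I k) : P3Ring)) (fun _ => 1)
    fun k _ => isHomogeneous_X ℂ (I k)
  simpa [cechForm] using h

theorem mem_cechOpen_iff_forall {p : ℕ} (I : Fin p ↪o Fin 4) (q : P3) :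
    q ∈ cechOpen I ↔ ∀ k, (X (I k) : P3Ring) ∉ q.asHomogeneousIdeal.toIdeal := by
  rw [cechOpen, ← SetLike.mem_coe, TopologicalSpace.Opens.coe_iInf, Set.mem_iInter]
  rfl

theorem mem_cechOpen_iff {p : ℕ} (I : Fin p ↪o Fin 4) (q : P3) :
    q ∈ cechOpen I ↔ cechForm I ∉ q.asHomogeneousIdeal.toIdeal := by
  rw [mem_cechOpen_iff_forall, cechForm, q.isPrime.prod_mem_iff]
  simp

variable {M : Type} [AddCommGroup M] [Module P3Ring M]
  {ℳ : ℕ → AddSubgroup M} [SetLike.GradedSMul p3Grading ℳ]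

theorem cechD_apply {n : ℤ} {p : ℕ} (s : CechCochain ℳ n p) (I : Fin (p + 2) ↪o Fin 4) :
    cechD ℳ n p s I = ∑ k : Fin (p + 2), (-1 : ℤ) ^ (k : ℕ) •
      restrictSection ℳ n (cechOpen_le_face I k) (s ((Fin.succAboveOrderEmb k).trans I)) := rfl

/-- The germs at a fixed point of the components of a cochain, extended by zero to the simplices
whose open set does not contain the point. -/
def cochainGerm {n : ℤ} {p : ℕ} (s : CechCochain ℳ n p) (q : P3) (I : Fin (p + 1) ↪o Fin 4) :
    StalkAt M q :=
  open Classical in if h : q ∈ cechOpen I then (s I).1 ⟨q, h⟩ else 0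

theorem cechD_germ {n : ℤ} {p : ℕ} (s : CechCochain ℳ n p) {q : P3} {I : Fin (p + 2) ↪o Fin 4}
    (h : q ∈ cechOpen I) : (cechD ℳ n p s I).1 ⟨q, h⟩ = orderedD (cochainGerm s q) I := by
  rw [cechD_apply, orderedD, AddSubgroup.val_finsetSum, Finset.sum_apply]
  refine Finset.sum_congr rfl fun k _ => ?_
  rw [AddSubgroup.coe_zsmul, Pi.smul_apply, cochainGerm, dif_pos (cechOpen_le_face I k h)]
  rfl

theorem cechD_cechD {n : ℤ} {p : ℕ} (s : CechCochain ℳ n p) :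
    cechD ℳ n (p + 1) (cechD ℳ n p s) = 0 := by
  funext I
  ext ⟨q, hq⟩
  rw [cechD_germ, Pi.zero_apply, AddSubgroup.coe_zero, Pi.zero_apply,
    ← orderedD_orderedD (cochainGerm s q) I]
  refine Finset.sum_congr rfl fun k _ => ?_
  rw [cochainGerm, dif_pos (cechOpen_le_face I k hq), cechD_germ]

/-- Vanishing of `Hⁱ⁺¹(ℙ³, M~(n))`: every Čech cocycle of degree `i + 1` is a coboundary. -/
def CechVanish (ℳ : ℕ → AddSubgroup M) [SetLike.GradedSMul p3Grading ℳ] (n : ℤ) (i : ℕ) : Prop :=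
  ∀ s : CechCochain ℳ n (i + 1), cechD ℳ n (i + 1) s = 0 → ∃ t, cechD ℳ n i t = s

theorem CechVanish.subsingleton {n : ℤ} {i : ℕ} (h : CechVanish ℳ n i) :
    Subsingleton (PosCohomology ℳ n i) := by
  rw [PosCohomology, QuotientAddGroup.subsingleton_iff, AddSubgroup.addSubgroupOf_eq_top]
  intro s hs
  exact h s hs

/-- The cover has four members, so there is no cohomology above degree three. -/
theorem cechVanish_of_three_le (n : ℤ) {i : ℕ} (hi : 3 ≤ i) : CechVanish ℳ n i := by
  intro s _
  refine ⟨0, funext fun I => ?_⟩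
  have := Fintype.card_le_of_embedding I.toEmbedding
  simp at this
  omega

variable {M' : Type} [AddCommGroup M'] [Module P3Ring M']
  {ℳ' : ℕ → AddSubgroup M'} [SetLike.GradedSMul p3Grading ℳ']
  {M'' : Type} [AddCommGroup M''] [Module P3Ring M'']
  {ℳ'' : ℕ → AddSubgroup M''} [SetLike.GradedSMul p3Grading ℳ'']

/-- The map on sections `Γ(U, M~(n)) → Γ(U, M'~(n'))`, `n' = n + c`, induced by a linear map that
raises degrees by `c`. -/
def mapSections {φ : M →ₗ[P3Ring] M'} {c : ℕ} (hφ : ∀ k, ∀ m ∈ ℳ k, φ m ∈ ℳ' (k + c))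
    {n n' : ℤ} (hn : n' = n + c) (U : TopologicalSpace.Opens P3) :
    twistedSections ℳ n U →+ twistedSections ℳ' n' U where
  toFun s := ⟨fun p => LocalizedModule.map p.1.asHomogeneousIdeal.toIdeal.primeCompl φ (s.1 p), by
    intro p
    obtain ⟨V, hpV, hVU, k, e, m, f, hk, hm, hf, hs⟩ := s.2 p
    refine ⟨V, hpV, hVU, k + c, e, φ m, f, by push_cast; omega, hφ k m hm, hf, fun q => ?_⟩
    obtain ⟨h1, h2⟩ := hs q
    exact ⟨h1, (congrArg _ h2).trans (LocalizedModule.map_mk ..)⟩⟩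
  map_zero' := by
    ext p
    exact map_zero _
  map_add' s t := by
    ext p
    exact map_add _ _ _

/-- The map on Čech cochains induced by a linear map that raises degrees by `c`. -/
def mapCochain {φ : M →ₗ[P3Ring] M'} {c : ℕ} (hφ : ∀ k, ∀ m ∈ ℳ k, φ m ∈ ℳ' (k + c))
    {n n' : ℤ} (hn : n' = n + c) {p : ℕ} (s : CechCochain ℳ n p) : CechCochain ℳ' n' p :=
  fun I => mapSections hφ hn _ (s I)

theorem cechD_mapCochain {φ : M →ₗ[P3Ring] M'} {c : ℕ} (hφ : ∀ k, ∀ m ∈ ℳ k, φ m ∈ ℳ' (k + c))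
    {n n' : ℤ} (hn : n' = n + c) {p : ℕ} (s : CechCochain ℳ n p) :
    cechD ℳ' n' p (mapCochain hφ hn s) = mapCochain hφ hn (cechD ℳ n p s) := by
  funext I
  rw [mapCochain, cechD_apply, cechD_apply, map_sum]
  refine Finset.sum_congr rfl fun k _ => ?_
  rw [map_zsmul]
  rfl

theorem mapCochain_sub {φ : M →ₗ[P3Ring] M'} {c : ℕ} (hφ : ∀ k, ∀ m ∈ ℳ k, φ m ∈ ℳ' (k + c))
    {n n' : ℤ} (hn : n' = n + c) {p : ℕ} (s t : CechCochain ℳ n p) :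
    mapCochain hφ hn (s - t) = mapCochain hφ hn s - mapCochain hφ hn t :=
  funext fun _ => map_sub _ _ _

theorem mapCochain_zero {φ : M →ₗ[P3Ring] M'} {c : ℕ} (hφ : ∀ k, ∀ m ∈ ℳ k, φ m ∈ ℳ' (k + c))
    {n n' : ℤ} (hn : n' = n + c) {p : ℕ} :
    mapCochain hφ hn (0 : CechCochain ℳ n p) = 0 :=
  funext fun _ => map_zero _

/-- Vanishing of cohomology passes to a graded retract. -/
theorem CechVanish.of_retract {φ : M →ₗ[P3Ring] M'} {ψ : M' →ₗ[P3Ring] M}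
    (hφ : ∀ k, ∀ m ∈ ℳ k, φ m ∈ ℳ' k) (hψ : ∀ k, ∀ m ∈ ℳ' k, ψ m ∈ ℳ k)
    (hφψ : ∀ m, φ (ψ m) = m) {n : ℤ} {i : ℕ} (h : CechVanish ℳ n i) : CechVanish ℳ' n i := by
  have hn : n = n + (0 : ℕ) := by simp
  intro s hs
  obtain ⟨t, ht⟩ := h (mapCochain (c := 0) hψ hn s) (by
    rw [cechD_mapCochain, hs, mapCochain_zero])
  refine ⟨mapCochain (c := 0) hφ hn t, ?_⟩
  rw [cechD_mapCochain, ht]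
  funext I
  ext q
  obtain ⟨m, u, hmu⟩ : ∃ m u, (s I).1 q = LocalizedModule.mk m u := by
    induction (s I).1 q using LocalizedModule.induction_on with
    | h m u => exact ⟨m, u, rfl⟩
  change LocalizedModule.map _ φ (LocalizedModule.map _ ψ ((s I).1 q)) = (s I).1 q
  rw [hmu, LocalizedModule.map_mk, LocalizedModule.map_mk, hφψ]

/-- A short exact sequence `0 → M' → M → M'' → 0` of graded modules whose maps raise degrees by
`c'` and `c''`; exactness in the middle and on the right is only asked of homogeneous elements. -/
structure GradedSES (ℳ' : ℕ → AddSubgroup M') (ℳ : ℕ → AddSubgroup M) (ℳ'' : ℕ → AddSubgroup M'')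
    (φ : M' →ₗ[P3Ring] M) (ψ : M →ₗ[P3Ring] M'') (c' c'' : ℕ) : Prop where
  φ_mem : ∀ k, ∀ m ∈ ℳ' k, φ m ∈ ℳ (k + c')
  ψ_mem : ∀ k, ∀ m ∈ ℳ k, ψ m ∈ ℳ'' (k + c'')
  φ_injective : Function.Injective φ
  ψ_comp_φ : ∀ m, ψ (φ m) = 0
  exact : ∀ k, ∀ m ∈ ℳ (k + c'), ψ m = 0 → ∃ m' ∈ ℳ' k, φ m' = m
  ψ_surjective : ∀ k, ∀ m'' ∈ ℳ'' (k + c''), ∃ m ∈ ℳ k, ψ m = m''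

namespace GradedSES

variable {φ : M' →ₗ[P3Ring] M} {ψ : M →ₗ[P3Ring] M''} {c' c'' : ℕ}
  {n' n n'' : ℤ} {p : ℕ}

omit [SetLike.GradedSMul p3Grading ℳ''] in
theorem mapCochain_injective (h : GradedSES ℳ' ℳ ℳ'' φ ψ c' c'') (hn : n = n' + c')
    {s : CechCochain ℳ' n' p} (hs : mapCochain h.φ_mem hn s = 0) : s = 0 := by
  funext I
  ext q
  refine LocalizedModule.map_injective _ φ h.φ_injective ?_
  rw [Pi.zero_apply, AddSubgroup.coe_zero, Pi.zero_apply, map_zero]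
  exact congrFun (congrArg Subtype.val (congrFun hs I)) q

theorem mapCochain_comp (h : GradedSES ℳ' ℳ ℳ'' φ ψ c' c'') (hn : n = n' + c')
    (hn'' : n'' = n + c'') (s : CechCochain ℳ' n' p) :
    mapCochain h.ψ_mem hn'' (mapCochain h.φ_mem hn s) = 0 := by
  funext I
  ext q
  change LocalizedModule.map _ ψ (LocalizedModule.map _ φ ((s I).1 q)) = 0
  induction (s I).1 q using LocalizedModule.induction_on with
  | h m u => rw [LocalizedModule.map_mk, LocalizedModule.map_mk, h.ψ_comp_φ,
      LocalizedModule.zero_mk]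

omit [SetLike.GradedSMul p3Grading ℳ'] in
theorem mapCochain_surjective (h : GradedSES ℳ' ℳ ℳ'' φ ψ c' c'')
    (hℳ'' : GradedIndependent ℳ'') (hn'' : n'' = n + c'') (s : CechCochain ℳ'' n'' p) :
    ∃ t : CechCochain ℳ n p, mapCochain h.ψ_mem hn'' t = s := by
  have key : ∀ I, ∃ t : twistedSections ℳ n (cechOpen I), mapSections h.ψ_mem hn'' _ t = s I := by
    intro I
    obtain ⟨N, k, m, hbk, hk, hm, hs⟩ := exists_eq_fraction hℳ'' p.succ_pos (cechForm_mem I)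
      (mem_cechOpen_iff I) (s I) c''
    obtain ⟨k, rfl⟩ := Nat.exists_eq_add_of_le' hbk
    obtain ⟨m, hm', rfl⟩ := h.ψ_surjective k m hm
    have hf : cechForm I ^ N ∈ p3Grading (N * (p + 1)) := by
      simpa using SetLike.pow_mem_graded N (cechForm_mem I)
    have hq : ∀ q ∈ cechOpen I, cechForm I ^ N ∉ q.asHomogeneousIdeal.toIdeal :=
      fun q hq h => (mem_cechOpen_iff I q).1 hq (q.isPrime.mem_of_pow_mem _ h)
    refine ⟨fractionSection ℳ (cechOpen I) (k := k) (by push_cast at hk ⊢; omega) m hm' _ hf hq,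
      ?_⟩
    ext q
    rw [hs q (hq q.1 q.2)]
    exact LocalizedModule.map_mk _ ψ m _
  choose t ht using key
  exact ⟨t, funext ht⟩

theorem mapCochain_exact (h : GradedSES ℳ' ℳ ℳ'' φ ψ c' c'') (hℳ : GradedIndependent ℳ)
    (hℳ'' : GradedIndependent ℳ'') (hn : n = n' + c') (hn'' : n'' = n + c'')
    (s : CechCochain ℳ n p) (hs0 : mapCochain h.ψ_mem hn'' s = 0) :
    ∃ t : CechCochain ℳ' n' p, mapCochain h.φ_mem hn t = s := by
  have key : ∀ I, ∃ t : twistedSections ℳ' n' (cechOpen I), mapSections h.φ_mem hn _ t = s I := by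
    intro I
    obtain ⟨N, k, m, hbk, hk, hm, hs⟩ := exists_eq_fraction hℳ p.succ_pos (cechForm_mem I)
      (mem_cechOpen_iff I) (s I) c'
    have hq : ∀ N, ∀ q ∈ cechOpen I, cechForm I ^ N ∉ q.asHomogeneousIdeal.toIdeal :=
      fun N q hq h => (mem_cechOpen_iff I q).1 hq (q.isPrime.mem_of_pow_mem _ h)
    -- The numerator dies in `M''` after multiplication by a power of the denominator.
    obtain ⟨K, hK⟩ := exists_pow_smul_eq_zero hℳ'' (h.ψ_mem k m hm) p.succ_pos (cechForm_mem I)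
      (fun q hqI => by
        have hqI := (mem_cechOpen_iff I q).2 hqI
        have h1 : LocalizedModule.map q.asHomogeneousIdeal.toIdeal.primeCompl ψ
            ((s I).1 ⟨q, hqI⟩) = 0 := congrFun (congrArg Subtype.val (congrFun hs0 I)) ⟨q, hqI⟩
        rw [hs ⟨q, hqI⟩ (hq N q hqI), LocalizedModule.map_mk,
          localizedModule_mk_eq_zero_iff] at h1
        obtain ⟨u, hu, h2⟩ := h1
        exact ⟨u, hu, h2⟩)
    have hfK : ∀ K, cechForm I ^ K ∈ p3Grading (K * (p + 1)) := fun K => by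
      simpa using SetLike.pow_mem_graded K (cechForm_mem I)
    have hm2 := smul_mem_grading (hfK K) hm
    obtain ⟨k, rfl⟩ := Nat.exists_eq_add_of_le' hbk
    rw [← add_assoc] at hm2
    obtain ⟨m', hm', hφm'⟩ := h.exact _ _ hm2 (by rw [map_smul, hK])
    refine ⟨fractionSection ℳ' (cechOpen I) (k := K * (p + 1) + k) (e := (K + N) * (p + 1))
      (by push_cast at hk ⊢; rw [add_mul]; omega) m' hm' _ (hfK (K + N)) (hq _), ?_⟩
    ext q
    rw [hs q (hq N q.1 q.2)]
    refine (LocalizedModule.map_mk _ φ m' _).trans ?_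
    rw [hφm', LocalizedModule.mk_eq]
    refine ⟨1, ?_⟩
    simp only [Submonoid.smul_def, smul_smul, pow_add, Submonoid.coe_one, one_mul]
    rw [mul_comm]
  choose t ht using key
  exact ⟨t, funext ht⟩

/-- If `Hⁱ⁺¹(M) = 0` and `Hⁱ⁺²(M') = 0`, then `Hⁱ⁺¹(M'') = 0`. -/
theorem cechVanish_right (h : GradedSES ℳ' ℳ ℳ'' φ ψ c' c'') (hℳ : GradedIndependent ℳ)
    (hℳ'' : GradedIndependent ℳ'') {i : ℕ} (hn : n = n' + c') (hn'' : n'' = n + c'')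
    (hv : CechVanish ℳ n i) (hv' : CechVanish ℳ' n' (i + 1)) : CechVanish ℳ'' n'' i := by
  intro s hs
  obtain ⟨s, rfl⟩ := h.mapCochain_surjective hℳ'' hn'' s
  rw [cechD_mapCochain] at hs
  obtain ⟨s', hs'⟩ := h.mapCochain_exact hℳ hℳ'' hn hn'' _ hs
  obtain ⟨t', rfl⟩ := hv' s' (h.mapCochain_injective hn (by
    rw [← cechD_mapCochain, hs', cechD_cechD]))
  obtain ⟨t, ht⟩ := hv (s - mapCochain h.φ_mem hn t') (by
    rw [map_sub, cechD_mapCochain, hs', sub_self])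
  exact ⟨mapCochain h.ψ_mem hn'' t, by
    rw [cechD_mapCochain, ht, mapCochain_sub, h.mapCochain_comp hn hn'', sub_zero]⟩

/-- If `Hⁱ⁺¹(M') = 0` and `Hⁱ⁺¹(M'') = 0`, then `Hⁱ⁺¹(M) = 0`. -/
theorem cechVanish_middle (h : GradedSES ℳ' ℳ ℳ'' φ ψ c' c'') (hℳ : GradedIndependent ℳ)
    (hℳ'' : GradedIndependent ℳ'') {i : ℕ} (hn : n = n' + c') (hn'' : n'' = n + c'')
    (hv' : CechVanish ℳ' n' i) (hv'' : CechVanish ℳ'' n'' i) : CechVanish ℳ n i := by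
  intro s hs
  obtain ⟨t, ht⟩ := hv'' (mapCochain h.ψ_mem hn'' s) (by
    rw [cechD_mapCochain, hs, mapCochain_zero])
  obtain ⟨t, rfl⟩ := h.mapCochain_surjective hℳ'' hn'' t
  obtain ⟨s', hs'⟩ := h.mapCochain_exact hℳ hℳ'' hn hn'' (s - cechD ℳ n i t) (by
    rw [mapCochain_sub, ← cechD_mapCochain, ht, sub_self])
  obtain ⟨u, rfl⟩ := hv' s' (h.mapCochain_injective hn (by
    rw [← cechD_mapCochain, hs', map_sub, hs, cechD_cechD, sub_self]))
  refine ⟨t + mapCochain h.φ_mem hn u, ?_⟩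
  rw [map_add, cechD_mapCochain, hs', add_sub_cancel]

end GradedSES

end CechComplex

/-! ### The cohomology of the twists of the structure sheaf -/

section StructureSheaf

/-- The Laurent polynomial ring `ℂ[x₀^±¹, …, x₃^±¹]`. -/
abbrev LaurentRing : Type := AddMonoidAlgebra ℂ (Fin 4 → ℤ)

/-- The inclusion of exponent vectors `ℕ⁴ → ℤ⁴`. -/
def exponentHom : (Fin 4 →₀ ℕ) →+ (Fin 4 → ℤ) where
  toFun a i := a i
  map_zero' := by ext; simp
  map_add' a b := by ext; simp

theorem exponentHom_injective : Function.Injective exponentHom := fun a b h => by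
  ext i
  exact Int.ofNat_inj.1 (congrFun h i)

/-- The inclusion of the polynomial ring into the Laurent polynomial ring. -/
def toLaurent : P3Ring →+* LaurentRing := AddMonoidAlgebra.mapDomainRingHom ℂ exponentHom

theorem toLaurent_injective : Function.Injective toLaurent :=
  AddMonoidAlgebra.mapDomain_injective exponentHom_injective

theorem toLaurent_monomial (a : Fin 4 →₀ ℕ) (r : ℂ) :
    toLaurent (monomial a r) = AddMonoidAlgebra.single (exponentHom a) r :=
  AddMonoidAlgebra.mapDomain_single

theorem exists_of_coeff_toLaurent_ne_zero {g : P3Ring} {e : Fin 4 → ℤ}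
    (h : (toLaurent g).coeff e ≠ 0) : ∃ a, coeff a g ≠ 0 ∧ exponentHom a = e := by
  classical
  have h1 : e ∈ (Finsupp.mapDomain exponentHom (AddMonoidAlgebra.coeff g)).support :=
    Finsupp.mem_support_iff.2 h
  obtain ⟨a, ha, rfl⟩ := Finset.mem_image.1 (Finsupp.mapDomain_support h1)
  exact ⟨a, Finsupp.mem_support_iff.1 ha, rfl⟩

/-- The degree `n` part of the localization of `S` at the variables indexed by `T`, as a subgroup
of the Laurent polynomial ring. -/
def laurentPart (n : ℤ) (T : Finset (Fin 4)) : AddSubgroup LaurentRing where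
  carrier := {ℓ | ∀ e, ℓ.coeff e ≠ 0 → ∑ i, e i = n ∧ ∀ i ∉ T, 0 ≤ e i}
  zero_mem' := fun e h => absurd rfl h
  add_mem' {a b} ha hb e h := by
    by_cases h1 : a.coeff e = 0
    · exact hb e fun h2 => h (by simp [h1, h2])
    · exact ha e h1
  neg_mem' {a} ha e h := ha e fun h1 => h (by
    rw [show (-a).coeff e = -(a.coeff e) from rfl, h1, neg_zero])

/-- The grading of `S`, regarded as a graded module over itself. -/
def ringGrading (k : ℕ) : AddSubgroup P3Ring := (p3Grading k).toAddSubgroup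

instance ringGrading_gradedSMul : SetLike.GradedSMul p3Grading ringGrading where
  smul_mem _ _ _ _ hf hm := SetLike.GradedMul.mul_mem (A := p3Grading) hf hm

theorem gradedIndependent_ringGrading : GradedIndependent ringGrading := by
  intro s m hm hs i hi
  have h := congrArg (homogeneousComponent i) hs
  rw [map_sum, map_zero, Finset.sum_eq_single_of_mem i hi] at h
  · rwa [homogeneousComponent_of_mem_self (hm i)] at h
  · intro j _ hj
    rw [homogeneousComponent_of_mem (hm j), if_neg hj.symm]

/-- The pairs of a section of `𝒪(n)` over `U` and a Laurent polynomial that represents it at every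
point of `U`. -/
def laurentGraph (n : ℤ) (U : TopologicalSpace.Opens P3) :
    AddSubgroup (twistedSections ringGrading n U × LaurentRing) where
  carrier := {x | ∀ q : U, ∃ (g : P3Ring) (u : q.1.asHomogeneousIdeal.toIdeal.primeCompl),
    x.1.1 q = LocalizedModule.mk g u ∧ toLaurent g = toLaurent u * x.2}
  zero_mem' q := ⟨0, 1, (LocalizedModule.zero_mk _).symm, by simp⟩
  add_mem' {x y} hx hy q := by
    obtain ⟨g, u, h1, h2⟩ := hx q
    obtain ⟨g', u', h3, h4⟩ := hy q
    refine ⟨u' • g + u • g', u * u', ?_, ?_⟩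
    · rw [← LocalizedModule.mk_add_mk, ← h1, ← h3]
      rfl
    · simp only [Submonoid.smul_def, smul_eq_mul, map_add, map_mul, Submonoid.coe_mul, h2, h4,
        Prod.snd_add]
      ring
  neg_mem' {x} hx q := by
    obtain ⟨g, u, h1, h2⟩ := hx q
    refine ⟨-g, u, ?_, ?_⟩
    · rw [LocalizedModule.mk_neg, ← h1]
      rfl
    · rw [map_neg, h2, Prod.snd_neg, mul_neg]

/-- The generic point of `ℙ³`. -/
def p3GenericPoint : P3 where
  asHomogeneousIdeal := ⊥
  isPrime := by
    rw [HomogeneousIdeal.toIdeal_bot]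
    exact Ideal.isPrime_bot
  not_irrelevant_le h := by
    have h1 : (X 0 : P3Ring) ∈ HomogeneousIdeal.irrelevant p3Grading := by
      rw [HomogeneousIdeal.mem_irrelevant_iff, GradedRing.proj_apply,
        DirectSum.decompose_of_mem_ne _ (isHomogeneous_X ℂ (0 : Fin 4)) one_ne_zero]
    exact X_ne_zero (R := ℂ) (0 : Fin 4) (h h1)

theorem mem_p3GenericPoint_iff (f : P3Ring) :
    f ∈ p3GenericPoint.asHomogeneousIdeal.toIdeal ↔ f = 0 := by
  rw [p3GenericPoint, HomogeneousIdeal.toIdeal_bot, Ideal.mem_bot]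

theorem p3GenericPoint_mem_cechOpen {p : ℕ} (I : Fin p ↪o Fin 4) : p3GenericPoint ∈ cechOpen I := by
  rw [mem_cechOpen_iff, mem_p3GenericPoint_iff, cechForm, Finset.prod_eq_zero_iff]
  simp

variable {n : ℤ} {p : ℕ}

theorem eq_zero_of_mem_laurentGraph {U : TopologicalSpace.Opens P3}
    {s : twistedSections ringGrading n U} (h : (s, 0) ∈ laurentGraph n U) : s = 0 := by
  ext q
  obtain ⟨g, u, h1, h2⟩ := h q
  rw [mul_zero] at h2
  obtain rfl : g = 0 := toLaurent_injective (h2.trans (map_zero _).symm)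
  exact h1.trans (LocalizedModule.zero_mk _)

theorem laurent_eq_zero_of_mem_laurentGraph {I : Fin p ↪o Fin 4} {ℓ : LaurentRing}
    (h : (0, ℓ) ∈ laurentGraph n (cechOpen I)) : ℓ = 0 := by
  obtain ⟨g, u, h1, h2⟩ := h ⟨p3GenericPoint, p3GenericPoint_mem_cechOpen I⟩
  obtain ⟨v, hv, h3⟩ := (localizedModule_mk_eq_zero_iff g u).1 h1.symm
  have hg : g = 0 := (mul_eq_zero.1 h3).resolve_left fun h => hv ((mem_p3GenericPoint_iff v).2 h)
  rw [hg, map_zero, eq_comm, mul_eq_zero] at h2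
  refine h2.resolve_left fun h => u.2 ((mem_p3GenericPoint_iff _).2 ?_)
  exact toLaurent_injective (h.trans (map_zero _).symm)

theorem cechForm_pow_eq_monomial (I : Fin p ↪o Fin 4) (N : ℕ) :
    ∃ b : Fin 4 →₀ ℕ, cechForm I ^ N = monomial b 1 ∧ ∀ i ∉ simplexVertices I, b i = 0 := by
  classical
  refine ⟨N • ∑ k, Finsupp.single (I k) 1, ?_, fun i hi => ?_⟩
  · rw [cechForm, ← one_pow (M := ℂ) N, ← monomial_pow, monomial_sum_one]
    rfl
  · rw [Finsupp.smul_apply, Finsupp.finsetSum_apply, Finset.sum_eq_zero, smul_zero]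
    intro k _
    rw [Finsupp.single_apply, if_neg]
    rintro rfl
    exact hi ((mem_simplexVertices I _).2 ⟨k, rfl⟩)

theorem exponentHom_sum (a : Fin 4 →₀ ℕ) : ∑ i, exponentHom a i = (a.degree : ℤ) := by
  rw [Finsupp.degree_eq_sum]
  push_cast
  rfl

/-- Every section of `𝒪(n)` over a member of the Čech cover is a Laurent polynomial. -/
theorem exists_laurent (I : Fin (p + 1) ↪o Fin 4)
    (s : twistedSections ringGrading n (cechOpen I)) :
    ∃ ℓ ∈ laurentPart n (simplexVertices I), (s, ℓ) ∈ laurentGraph n (cechOpen I) := by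
  obtain ⟨N, k, g, -, hk, hg, hs⟩ := exists_eq_fraction gradedIndependent_ringGrading p.succ_pos
    (cechForm_mem I) (mem_cechOpen_iff I) s 0
  obtain ⟨b, hb, hbI⟩ := cechForm_pow_eq_monomial I N
  have hbdeg : b.degree = N * (p + 1) := by
    have h1 : cechForm I ^ N ∈ p3Grading (N * (p + 1)) := by
      simpa using SetLike.pow_mem_graded N (cechForm_mem I)
    by_contra hne
    have h2 := (show IsHomogeneous (cechForm I ^ N) _ from h1).coeff_eq_zero hne
    simp [hb] at h2
  refine ⟨AddMonoidAlgebra.single (-exponentHom b) 1 * toLaurent g, fun e he => ?_, fun q => ?_⟩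
  · rw [AddMonoidAlgebra.coeff_single_mul_apply, one_mul, neg_neg] at he
    obtain ⟨a, ha, hae⟩ := exists_of_coeff_toLaurent_ne_zero he
    have hdeg : a.degree = k := by
      by_contra hne
      exact ha ((show IsHomogeneous g k from hg).coeff_eq_zero hne)
    have hei : ∀ i, e i = a i - b i := fun i => by
      have := congrFun hae i
      simp only [exponentHom, AddMonoidHom.coe_mk, ZeroHom.coe_mk, Pi.add_apply] at this
      omega
    constructor
    · have h1 : ∑ i, exponentHom a i = ∑ i, exponentHom b i + ∑ i, e i := by
        rw [hae, ← Finset.sum_add_distrib]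
        rfl
      rw [exponentHom_sum, exponentHom_sum, hdeg, hbdeg, hk] at h1
      linarith
    · intro i hi
      rw [hei, hbI i hi]
      simp
  · have hq : cechForm I ^ N ∉ q.1.asHomogeneousIdeal.toIdeal :=
      fun h => (mem_cechOpen_iff I q.1).1 q.2 (q.1.isPrime.mem_of_pow_mem _ h)
    refine ⟨g, ⟨_, hq⟩, hs q hq, ?_⟩
    rw [← mul_assoc]
    change _ = toLaurent (cechForm I ^ N) * _ * _
    rw [hb, toLaurent_monomial, AddMonoidAlgebra.single_mul_single, add_neg_cancel, one_mul,
      ← AddMonoidAlgebra.one_def, one_mul]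

/-- Every Laurent polynomial of degree `n` without poles outside `∏ x_{i_k} = 0` is a section of
`𝒪(n)` over the corresponding member of the Čech cover. -/
theorem exists_section (I : Fin p ↪o Fin 4) {ℓ : LaurentRing}
    (hℓ : ℓ ∈ laurentPart n (simplexVertices I)) :
    ∃ s, (s, ℓ) ∈ laurentGraph n (cechOpen I) := by
  suffices h : ℓ ∈ (laurentGraph n (cechOpen I)).map (AddMonoidHom.snd _ _) by
    obtain ⟨⟨s, ℓ'⟩, h1, rfl⟩ := h
    exact ⟨s, h1⟩
  have hsum : ℓ = ∑ e ∈ ℓ.coeff.support, AddMonoidAlgebra.single e (ℓ.coeff e) := by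
    apply AddMonoidAlgebra.coeff_injective
    rw [AddMonoidAlgebra.coeff_sum]
    exact (Finsupp.sum_single ℓ.coeff).symm
  rw [hsum]
  refine sum_mem fun e he => ?_
  obtain ⟨hen, heI⟩ := hℓ e (Finsupp.mem_support_iff.1 he)
  -- The monomial `x ^ e` is the quotient of the monomials of the positive and negative parts
  -- of `e`.
  set a : Fin 4 →₀ ℕ := Finsupp.equivFunOnFinite.symm fun i => (e i).toNat with ha
  set b : Fin 4 →₀ ℕ := Finsupp.equivFunOnFinite.symm fun i => (-e i).toNat with hb
  have hab : exponentHom a = exponentHom b + e := by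
    ext i
    simp only [exponentHom, AddMonoidHom.coe_mk, ZeroHom.coe_mk, Pi.add_apply, ha, hb,
      Finsupp.equivFunOnFinite_symm_apply_apply]
    omega
  have hbq : ∀ q ∈ cechOpen I, (monomial b 1 : P3Ring) ∉ q.asHomogeneousIdeal.toIdeal := by
    intro q hq h
    rw [monomial_eq, C_1, one_mul, Finsupp.prod_fintype _ _ (fun i => pow_zero _),
      q.isPrime.prod_mem_iff] at h
    obtain ⟨i, -, hi⟩ := h
    by_cases hiI : i ∈ simplexVertices I
    · obtain ⟨k, rfl⟩ := (mem_simplexVertices I i).1 hiI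
      exact (mem_cechOpen_iff_forall I q).1 hq k (q.isPrime.mem_of_pow_mem _ hi)
    · have hbi : b i = 0 := by
        have := heI i hiI
        simp only [hb, Finsupp.equivFunOnFinite_symm_apply_apply]
        omega
      rw [hbi, pow_zero] at hi
      exact q.isPrime.ne_top ((Ideal.eq_top_iff_one _).2 hi)
  have hdeg : (a.degree : ℤ) = n + b.degree := by
    rw [← exponentHom_sum, ← exponentHom_sum, hab, ← hen, add_comm, ← Finset.sum_add_distrib]
    rfl
  refine ⟨(fractionSection ringGrading (cechOpen I) hdeg (monomial a (ℓ.coeff e))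
    (isHomogeneous_monomial _ rfl) (monomial b 1) (isHomogeneous_monomial _ rfl) hbq, _),
    fun q => ⟨_, ⟨_, hbq q.1 q.2⟩, rfl, ?_⟩, rfl⟩
  change toLaurent _ = toLaurent _ * AddMonoidAlgebra.single _ _
  rw [toLaurent_monomial, toLaurent_monomial, AddMonoidAlgebra.single_mul_single, one_mul, hab]

/-- The part of a Laurent polynomial supported on the exponents satisfying `P`. -/
def laurentFilter (P : (Fin 4 → ℤ) → Prop) [DecidablePred P] : LaurentRing →+ LaurentRing :=
  AddMonoidAlgebra.coeffAddEquiv.symm.toAddMonoidHom.comp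
    ((Finsupp.filterAddHom P).comp AddMonoidAlgebra.coeffAddEquiv.toAddMonoidHom)

theorem coeff_laurentFilter (P : (Fin 4 → ℤ) → Prop) [DecidablePred P] (ℓ : LaurentRing)
    (e : Fin 4 → ℤ) : (laurentFilter P ℓ).coeff e = if P e then ℓ.coeff e else 0 :=
  Finsupp.filter_apply P ℓ.coeff e

/-- A coordinate in which the exponent `e` is nonnegative, if there is one. -/
def nonnegCoord (e : Fin 4 → ℤ) : Fin 4 :=
  open Classical in if h : ∃ i, 0 ≤ e i then h.choose else 0

theorem nonnegCoord_spec {e : Fin 4 → ℤ} (h : ∃ i, 0 ≤ e i) : 0 ≤ e (nonnegCoord e) := by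
  rw [nonnegCoord, dif_pos h]
  exact h.choose_spec

theorem cechD_mem_laurentGraph {s : CechCochain ringGrading n p}
    {ℓ : (Fin (p + 1) ↪o Fin 4) → LaurentRing} (h : ∀ I, (s I, ℓ I) ∈ laurentGraph n (cechOpen I))
    (I : Fin (p + 2) ↪o Fin 4) :
    (cechD ringGrading n p s I, orderedD ℓ I) ∈ laurentGraph n (cechOpen I) := by
  have h1 : (cechD ringGrading n p s I, orderedD ℓ I) = ∑ k : Fin (p + 2), (-1 : ℤ) ^ (k : ℕ) •
      (restrictSection ringGrading n (cechOpen_le_face I k) (s ((Fin.succAboveOrderEmb k).trans I)),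
        ℓ ((Fin.succAboveOrderEmb k).trans I)) := by
    ext1
    · rw [Prod.fst_sum]
      rfl
    · rw [Prod.snd_sum]
      rfl
  rw [h1]
  refine sum_mem fun k _ => zsmul_mem ?_ _
  exact fun q => h _ ⟨q.1, cechOpen_le_face I k q.2⟩

/-- `Hⁱ⁺¹(ℙ³, 𝒪(n)) = 0` for `i + 1 = 1, 2`, and for all `i` if `n ≥ -3`. Each cocycle is split
according to a coordinate `j` in which the exponents are nonnegative; coning the `j`-th part with
apex `j` creates no new poles. -/
theorem cechVanish_ringGrading {i : ℕ} (h : i ≤ 1 ∨ -3 ≤ n) : CechVanish ringGrading n i := by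
  intro s hs
  choose ℓ hℓ hsℓ using fun I => exists_laurent I (s I)
  have hD : ∀ J, orderedD ℓ J = 0 := fun J => by
    have h1 := cechD_mem_laurentGraph hsℓ J
    rw [hs] at h1
    exact laurent_eq_zero_of_mem_laurentGraph h1
  have hex : ∀ I e, (ℓ I).coeff e ≠ 0 → ∃ j, 0 ≤ e j := by
    intro I e he
    obtain ⟨h1, h2⟩ := hℓ I e he
    rcases h with h | h
    · obtain ⟨j, hj⟩ : ∃ j, j ∉ simplexVertices I := by
        by_contra! hall
        have h3 := card_simplexVertices I
        rw [Finset.eq_univ_iff_forall.2 hall] at h3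
        simp at h3
        omega
      exact ⟨j, h2 j hj⟩
    · by_contra! hall
      have h0 := hall 0
      have h3 := hall 1
      have h4 := hall 2
      have h5 := hall 3
      rw [Fin.sum_univ_four] at h1
      omega
  set c : Fin 4 → (Fin (i + 2) ↪o Fin 4) → LaurentRing :=
    fun j I => laurentFilter (fun e => nonnegCoord e = j) (ℓ I) with hc
  have hcD : ∀ j J, orderedD (c j) J = 0 := fun j J => by
    rw [← map_zero (laurentFilter (fun e => nonnegCoord e = j)), ← hD J, orderedD, orderedD,
      map_sum]
    exact Finset.sum_congr rfl fun k _ => (map_zsmul _ _ _).symm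
  have hcsum : ∀ I, ∑ j, c j I = ℓ I := fun I => by
    apply AddMonoidAlgebra.coeff_injective
    ext e
    simp [hc, AddMonoidAlgebra.coeff_sum, Finsupp.finsetSum_apply, coeff_laurentFilter]
  set b : (Fin (i + 1) ↪o Fin 4) → LaurentRing := fun I => ∑ j, orderedCone j (c j) I with hb
  have hbD : ∀ I, orderedD b I = ℓ I := fun I => by
    rw [← hcsum I]
    simp only [orderedD, hb, Finset.smul_sum]
    rw [Finset.sum_comm]
    exact Finset.sum_congr rfl fun j _ => orderedD_orderedCone j (c j) (hcD j) I
  have hbmem : ∀ I, b I ∈ laurentPart n (simplexVertices I) := fun I => by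
    refine sum_mem fun j _ => ?_
    obtain h0 | ⟨I', z, hI', hz⟩ := orderedCone_eq j (c j) I
    · rw [h0]
      exact zero_mem _
    · rw [hz]
      refine zsmul_mem ?_ z
      intro e he
      rw [hc, coeff_laurentFilter] at he
      have hj : nonnegCoord e = j := by
        by_contra hne
        exact he (if_neg hne)
      rw [if_pos hj] at he
      obtain ⟨h1, h2⟩ := hℓ I' e he
      refine ⟨h1, fun m hm => ?_⟩
      by_cases hmI' : m ∈ simplexVertices I'
      · rw [(hI' m hmI').resolve_right hm, ← hj]
        exact nonnegCoord_spec (hex I' e he)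
      · exact h2 m hmI'
  choose t ht using fun I => exists_section I (hbmem I)
  refine ⟨t, funext fun I => ?_⟩
  have h1 := sub_mem (cechD_mem_laurentGraph ht I) (hsℓ I)
  rw [hbD, Prod.mk_sub_mk, sub_self] at h1
  exact sub_eq_zero.1 (eq_zero_of_mem_laurentGraph h1)

end StructureSheaf

/-! ### Graded modules cut out by an ideal on a surface -/

section IdealModule

theorem homogeneousComponent_mem_ideal {K : Ideal P3Ring} (hK : K.IsHomogeneous p3Grading)
    {x : P3Ring} (hx : x ∈ K) (k : ℕ) : homogeneousComponent k x ∈ K := by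
  have := hK k hx
  rwa [← MvPolynomial.decomposition.decompose'_apply]

/-- The image of the ideal `K` in `S / (F)`, as an `S`-module. For `F = 0` it is a copy of `K`. -/
def idealModule (F : P3Ring) (K : Ideal P3Ring) : Submodule P3Ring (SurfaceRing F) :=
  (K.map (Ideal.Quotient.mk (Ideal.span {F}))).restrictScalars P3Ring

theorem mk_mem_idealModule {F : P3Ring} {K : Ideal P3Ring} {x : P3Ring} (hx : x ∈ K) :
    Ideal.Quotient.mk (Ideal.span {F}) x ∈ idealModule F K :=
  Ideal.mem_map_of_mem _ hx

theorem mem_of_mk_mem_idealModule {F : P3Ring} {K : Ideal P3Ring} (hF : F ∈ K) {x : P3Ring}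
    (hx : Ideal.Quotient.mk (Ideal.span {F}) x ∈ idealModule F K) : x ∈ K := by
  obtain ⟨y, hy, hyx⟩ :=
    (Ideal.mem_map_iff_of_surjective _ Ideal.Quotient.mk_surjective).1 hx
  rw [Ideal.Quotient.eq, Ideal.mem_span_singleton'] at hyx
  obtain ⟨z, hz⟩ := hyx
  rw [← sub_sub_cancel y x, ← hz]
  exact sub_mem hy (K.mul_mem_left z hF)

theorem mk_eq_zero_iff_dvd {F x : P3Ring} :
    Ideal.Quotient.mk (Ideal.span {F}) x = 0 ↔ F ∣ x := by
  rw [Ideal.Quotient.eq_zero_iff_mem, Ideal.mem_span_singleton]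

theorem gradedIndependent_inducedGrading {F : P3Ring} {e : ℕ} (hF : F ∈ p3Grading e)
    (N : Submodule P3Ring (SurfaceRing F)) : GradedIndependent (inducedGrading F N) := by
  intro s m hm hs i hi
  choose g hg hgm using hm
  have h1 : F ∣ ∑ j ∈ s, g j := by
    rw [← mk_eq_zero_iff_dvd, map_sum]
    simp only [hgm]
    rw [← AddSubmonoidClass.coe_finsetSum, hs]
    rfl
  obtain ⟨c, hc⟩ := h1
  have h2 := congrArg (homogeneousComponent i) hc
  rw [mul_comm, homogeneousComponent_mul_of_mem hF, map_sum, Finset.sum_eq_single_of_mem i hi,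
    homogeneousComponent_of_mem_self (hg i)] at h2
  · ext1
    rw [← hgm i]
    refine mk_eq_zero_iff_dvd.2 ?_
    rw [h2]
    split_ifs
    · exact dvd_mul_left _ _
    · exact dvd_zero _
  · intro j _ hj
    rw [homogeneousComponent_of_mem (hg j), if_neg hj.symm]

/-- Multiplication by `g`, as a map between modules cut out by ideals. -/
def mulMap {F F' : P3Ring} {K K' : Ideal P3Ring} (g : P3Ring) (hK : ∀ x ∈ K', g * x ∈ K)
    (hF : F ∣ g * F') : idealModule F' K' →ₗ[P3Ring] idealModule F K :=
  LinearMap.restrict (Submodule.mapQ (Ideal.span {F'}) (Ideal.span {F})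
    (LinearMap.lsmul P3Ring P3Ring g) (by
      rw [Ideal.span_le, Set.singleton_subset_iff]
      exact Ideal.mem_span_singleton.2 hF)) (by
    intro x hx
    obtain ⟨y, hy, rfl⟩ := (Ideal.mem_map_iff_of_surjective _ Ideal.Quotient.mk_surjective).1 hx
    exact mk_mem_idealModule (hK y hy))

theorem coe_mulMap {F F' : P3Ring} {K K' : Ideal P3Ring} {g : P3Ring} (hK : ∀ x ∈ K', g * x ∈ K)
    (hF : F ∣ g * F') {m : idealModule F' K'} {x : P3Ring}
    (hx : Ideal.Quotient.mk (Ideal.span {F'}) x = m.1) :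
    (mulMap g hK hF m).1 = Ideal.Quotient.mk (Ideal.span {F}) (g * x) := by
  obtain ⟨_, _⟩ := m
  subst hx
  rfl

/-- `F` is a form lying in the homogeneous ideal `K`. -/
structure IsGradedPair (F : P3Ring) (K : Ideal P3Ring) : Prop where
  exists_mem_grading : ∃ e, F ∈ p3Grading e
  mem : F ∈ K
  isHomogeneous : K.IsHomogeneous p3Grading

/-- The sequence `0 → K' / (F') → K / (F) → K'' / (F'') → 0`, with maps the multiplications by `g`
and `h`, is exact. -/
structure IdealSES (F' : P3Ring) (K' : Ideal P3Ring) (g F : P3Ring) (K : Ideal P3Ring)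
    (h F'' : P3Ring) (K'' : Ideal P3Ring) : Prop where
  mul_mem_left : ∀ x ∈ K', g * x ∈ K
  mul_mem_right : ∀ x ∈ K, h * x ∈ K''
  dvd_left : F ∣ g * F'
  dvd_right : F'' ∣ h * F
  injective : ∀ x ∈ K', F ∣ g * x → F' ∣ x
  comp : ∀ x ∈ K', F'' ∣ h * (g * x)
  exact : ∀ x ∈ K, F'' ∣ h * x → ∃ y ∈ K', F ∣ x - g * y
  surjective : ∀ y ∈ K'', ∃ x ∈ K, F'' ∣ y - h * x

/-- If a form is congruent modulo `F` to a multiple of `g` by an element of a homogeneous ideal,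
that element can be chosen homogeneous. -/
theorem exists_homogeneous_multiplier {F g x y : P3Ring} {K : Ideal P3Ring} {e c k : ℕ}
    (hF : F ∈ p3Grading e) (hg : g ∈ p3Grading c) (hK : K.IsHomogeneous p3Grading)
    (hx : x ∈ p3Grading (k + c)) (hy : y ∈ K) (h : F ∣ x - g * y) :
    ∃ z ∈ K, z ∈ p3Grading k ∧ F ∣ x - g * z := by
  refine ⟨homogeneousComponent k y, homogeneousComponent_mem_ideal hK hy k,
    homogeneousComponent_mem k y, ?_⟩
  obtain ⟨w, hw⟩ := h
  have h1 := congrArg (homogeneousComponent (k + c)) hw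
  rw [map_sub, homogeneousComponent_of_mem_self hx, mul_comm g,
    homogeneousComponent_mul_of_mem hg, if_pos (Nat.le_add_left c k), Nat.add_sub_cancel,
    mul_comm F, homogeneousComponent_mul_of_mem hF] at h1
  rw [mul_comm g, h1]
  split_ifs
  · exact dvd_mul_left _ _
  · exact dvd_zero _

variable {F' F F'' g h : P3Ring} {K' K K'' : Ideal P3Ring} {c' c'' : ℕ}

theorem IdealSES.gradedSES (H : IdealSES F' K' g F K h F'' K'') (hg : g ∈ p3Grading c')
    (hh : h ∈ p3Grading c'') (hK' : IsGradedPair F' K') (hK : IsGradedPair F K)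
    (hK'' : IsGradedPair F'' K'') :
    GradedSES (inducedGrading F' (idealModule F' K')) (inducedGrading F (idealModule F K))
      (inducedGrading F'' (idealModule F'' K'')) (mulMap g H.mul_mem_left H.dvd_left)
      (mulMap h H.mul_mem_right H.dvd_right) c' c'' where
  φ_mem k m hm := by
    obtain ⟨x, hx, hxm⟩ := hm
    refine ⟨g * x, ?_, (coe_mulMap _ _ hxm).symm⟩
    rw [add_comm]
    exact IsHomogeneous.mul hg hx
  ψ_mem k m hm := by
    obtain ⟨x, hx, hxm⟩ := hm
    refine ⟨h * x, ?_, (coe_mulMap _ _ hxm).symm⟩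
    rw [add_comm]
    exact IsHomogeneous.mul hh hx
  φ_injective := by
    rw [injective_iff_map_eq_zero]
    intro m hm
    obtain ⟨x, hx⟩ := Ideal.Quotient.mk_surjective m.1
    have hxK : x ∈ K' := mem_of_mk_mem_idealModule hK'.mem (hx ▸ m.2)
    have h1 := congrArg Subtype.val hm
    rw [coe_mulMap _ _ hx] at h1
    ext1
    rw [← hx]
    exact mk_eq_zero_iff_dvd.2 (H.injective x hxK (mk_eq_zero_iff_dvd.1 h1))
  ψ_comp_φ m := by
    obtain ⟨x, hx⟩ := Ideal.Quotient.mk_surjective m.1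
    have hxK : x ∈ K' := mem_of_mk_mem_idealModule hK'.mem (hx ▸ m.2)
    ext1
    rw [coe_mulMap _ _ (coe_mulMap H.mul_mem_left H.dvd_left hx).symm]
    exact mk_eq_zero_iff_dvd.2 (H.comp x hxK)
  exact k m hm hm0 := by
    obtain ⟨x, hx, hxm⟩ := hm
    have hxK : x ∈ K := mem_of_mk_mem_idealModule hK.mem (hxm ▸ m.2)
    have h1 := congrArg Subtype.val hm0
    rw [coe_mulMap _ _ hxm] at h1
    obtain ⟨y, hy, hxy⟩ := H.exact x hxK (mk_eq_zero_iff_dvd.1 h1)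
    obtain ⟨e, he⟩ := hK.exists_mem_grading
    obtain ⟨z, hzK, hz, hxz⟩ := exists_homogeneous_multiplier he hg hK'.isHomogeneous hx hy hxy
    refine ⟨⟨_, mk_mem_idealModule hzK⟩, ⟨z, hz, rfl⟩, ?_⟩
    ext1
    rw [coe_mulMap _ _ rfl, ← hxm, eq_comm, ← sub_eq_zero, ← map_sub]
    exact mk_eq_zero_iff_dvd.2 hxz
  ψ_surjective k m hm := by
    obtain ⟨x, hx, hxm⟩ := hm
    have hxK : x ∈ K'' := mem_of_mk_mem_idealModule hK''.mem (hxm ▸ m.2)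
    obtain ⟨y, hy, hxy⟩ := H.surjective x hxK
    obtain ⟨e, he⟩ := hK''.exists_mem_grading
    obtain ⟨z, hzK, hz, hxz⟩ := exists_homogeneous_multiplier he hh hK.isHomogeneous hx hy hxy
    refine ⟨⟨_, mk_mem_idealModule hzK⟩, ⟨z, hz, rfl⟩, ?_⟩
    ext1
    rw [coe_mulMap _ _ rfl, ← hxm, eq_comm, ← sub_eq_zero, ← map_sub]
    exact mk_eq_zero_iff_dvd.2 hxz

/-- Vanishing of `Hⁱ⁺¹(ℙ³, M~(n))` for `M` the image of `K` in `S / (F)`. -/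
def IdealVanish (F : P3Ring) (K : Ideal P3Ring) (n : ℤ) (i : ℕ) : Prop :=
  CechVanish (inducedGrading F (idealModule F K)) n i

theorem IdealSES.idealVanish_right (H : IdealSES F' K' g F K h F'' K'') (hg : g ∈ p3Grading c')
    (hh : h ∈ p3Grading c'') (hK' : IsGradedPair F' K') (hK : IsGradedPair F K)
    (hK'' : IsGradedPair F'' K'') {n : ℤ} {i : ℕ} (hv : IdealVanish F K (n - c'') i)
    (hv' : IdealVanish F' K' (n - c'' - c') (i + 1)) : IdealVanish F'' K'' n i := by
  obtain ⟨e, he⟩ := hK.exists_mem_grading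
  obtain ⟨e'', he''⟩ := hK''.exists_mem_grading
  exact (H.gradedSES hg hh hK' hK hK'').cechVanish_right (gradedIndependent_inducedGrading he _)
    (gradedIndependent_inducedGrading he'' _) (by ring) (by ring) hv hv'

theorem IdealSES.idealVanish_middle (H : IdealSES F' K' g F K h F'' K'') (hg : g ∈ p3Grading c')
    (hh : h ∈ p3Grading c'') (hK' : IsGradedPair F' K') (hK : IsGradedPair F K)
    (hK'' : IsGradedPair F'' K'') {n : ℤ} {i : ℕ} (hv' : IdealVanish F' K' (n - c') i)
    (hv'' : IdealVanish F'' K'' (n + c'') i) : IdealVanish F K n i := by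
  obtain ⟨e, he⟩ := hK.exists_mem_grading
  obtain ⟨e'', he''⟩ := hK''.exists_mem_grading
  exact (H.gradedSES hg hh hK' hK hK'').cechVanish_middle (gradedIndependent_inducedGrading he _)
    (gradedIndependent_inducedGrading he'' _) (by ring) (by ring) hv' hv''

/-- The module `S / (0)` has the cohomology of the structure sheaf. -/
theorem idealVanish_top {n : ℤ} {i : ℕ} (h : i ≤ 1 ∨ -3 ≤ n) : IdealVanish 0 ⊤ n i := by
  refine (cechVanish_ringGrading h).of_retract
    (φ := (Submodule.mkQ (Ideal.span {(0 : P3Ring)})).codRestrict (idealModule 0 ⊤)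
      fun x => mk_mem_idealModule Submodule.mem_top)
    (ψ := (Submodule.liftQ (Ideal.span {(0 : P3Ring)}) LinearMap.id (by
      simp)).comp (idealModule 0 ⊤).subtype) ?_ ?_ ?_
  · intro k m hm
    exact ⟨m, hm, rfl⟩
  · rintro k ⟨_, h1⟩ ⟨x, hx, rfl⟩
    exact hx
  · rintro ⟨m, hm⟩
    obtain ⟨x, rfl⟩ := Ideal.Quotient.mk_surjective m
    rfl

end IdealModule

/-! ### Two linear forms and a smooth surface -/

section LinearForms

theorem eval_smul_of_isHomogeneous {A : P3Ring} {m : ℕ} (hA : A.IsHomogeneous m) (t : ℂ)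
    (v : Fin 4 → ℂ) : eval (t • v) A = t ^ m * eval v A := by
  rw [eval_eq, eval_eq, Finset.mul_sum]
  refine Finset.sum_congr rfl fun b hb => ?_
  have hdeg : ∑ i ∈ b.support, b i = m := by
    by_contra hne
    exact mem_support_iff.1 hb (hA.coeff_eq_zero hne)
  simp only [Pi.smul_apply, smul_eq_mul, mul_pow, Finset.prod_mul_distrib]
  rw [Finset.prod_pow_eq_pow_sum, hdeg]
  ring

theorem isHomogeneous_one_induction {P : P3Ring → Prop} {l : P3Ring} (hl : l.IsHomogeneous 1)
    (h0 : P 0) (hX : ∀ i, P (X i)) (hadd : ∀ x y, P x → P y → P (x + y))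
    (hC : ∀ (c : ℂ) x, P x → P (c • x)) : P l := by
  have h : l ∈ Submodule.span ℂ (Set.range (X : Fin 4 → P3Ring)) := by
    rw [← homogeneousSubmodule_one_eq_span_X]
    exact hl
  clear hl
  induction h using Submodule.span_induction with
  | mem x hx => obtain ⟨i, rfl⟩ := hx; exact hX i
  | zero => exact h0
  | add x y _ _ hx hy => exact hadd x y hx hy
  | smul c x _ hx => exact hC c x hx

theorem exists_linearMap_eval {l : P3Ring} (hl : l.IsHomogeneous 1) :
    ∃ f : (Fin 4 → ℂ) →ₗ[ℂ] ℂ, ∀ v, f v = eval v l := by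
  refine isHomogeneous_one_induction (P := fun l => ∃ f : (Fin 4 → ℂ) →ₗ[ℂ] ℂ, ∀ v, f v = eval v l)
    hl ⟨0, fun v => by simp⟩
    (fun i => ⟨LinearMap.proj i, fun v => by simp⟩) ?_ ?_
  · rintro x y ⟨f, hf⟩ ⟨g, hg⟩
    exact ⟨f + g, fun v => by simp [hf, hg]⟩
  · rintro c x ⟨f, hf⟩
    exact ⟨c • f, fun v => by simp [hf, smul_eval]⟩

variable {l₁ l₂ : P3Ring}

theorem exists_dual_vectors (hl₁ : l₁.IsHomogeneous 1) (hl₂ : l₂.IsHomogeneous 1)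
    (hl : LinearIndependent ℂ ![l₁, l₂]) (a b : ℂ) : ∃ v, eval v l₁ = a ∧ eval v l₂ = b := by
  obtain ⟨f, hf⟩ := exists_linearMap_eval hl₁
  obtain ⟨g, hg⟩ := exists_linearMap_eval hl₂
  have hsurj : LinearMap.range (f.prod g) = ⊤ := by
    by_contra hne
    obtain ⟨φ, hφ0, hφ⟩ := Submodule.exists_le_ker_of_lt_top _ (lt_top_iff_ne_top.2 hne)
    have hφ' : ∀ x y, φ (x, y) = x * φ (1, 0) + y * φ (0, 1) := fun x y => by
      rw [← smul_eq_mul, ← smul_eq_mul, ← map_smul, ← map_smul, ← map_add]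
      simp
    have h1 : φ (1, 0) • l₁ + φ (0, 1) • l₂ = 0 := by
      refine MvPolynomial.funext fun v => ?_
      have h2 : φ (f v, g v) = 0 := hφ ⟨v, rfl⟩
      rw [hφ', hf, hg] at h2
      simp only [map_add, smul_eval, map_zero]
      linear_combination h2
    obtain ⟨h3, h4⟩ := LinearIndependent.pair_iff.1 hl _ _ h1
    apply hφ0
    ext
    · simpa using h3
    · simpa using h4
  obtain ⟨v, hv⟩ := (LinearMap.range_eq_top.1 hsurj) (a, b)
  exact ⟨v, by rw [← hf]; exact congrArg Prod.fst hv, by rw [← hg]; exact congrArg Prod.snd hv⟩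

theorem exists_common_zero (hl₁ : l₁.IsHomogeneous 1) (hl₂ : l₂.IsHomogeneous 1) :
    ∃ u : Fin 4 → ℂ, u ≠ 0 ∧ eval u l₁ = 0 ∧ eval u l₂ = 0 := by
  obtain ⟨f, hf⟩ := exists_linearMap_eval hl₁
  obtain ⟨g, hg⟩ := exists_linearMap_eval hl₂
  have h : LinearMap.ker (f.prod g) ≠ ⊥ := LinearMap.ker_ne_bot_of_finrank_lt (by simp)
  obtain ⟨u, hu, hu0⟩ := (Submodule.ne_bot_iff _).1 h
  exact ⟨u, hu0, by rw [← hf]; exact congrArg Prod.fst hu,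
    by rw [← hg]; exact congrArg Prod.snd hu⟩

theorem prime_of_isHomogeneous_one (hl₁ : l₁.IsHomogeneous 1) (h0 : l₁ ≠ 0) : Prime l₁ := by
  refine (irreducible_of_totalDegree_eq_one (hl₁.totalDegree h0) fun x hx => ?_).prime
  obtain ⟨i, hi⟩ := ne_zero_iff.1 h0
  refine isUnit_iff_ne_zero.2 ?_
  rintro rfl
  exact hi (zero_dvd_iff.1 (hx i))

/-- The ideal of a line is prime: it is the kernel of the substitution that projects along a
complement of the line. -/
theorem isPrime_span_pair (hl₁ : l₁.IsHomogeneous 1) (hl₂ : l₂.IsHomogeneous 1)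
    (hl : LinearIndependent ℂ ![l₁, l₂]) : (Ideal.span {l₁, l₂}).IsPrime := by
  obtain ⟨v, hv1, hv2⟩ := exists_dual_vectors hl₁ hl₂ hl 1 0
  obtain ⟨w, hw1, hw2⟩ := exists_dual_vectors hl₁ hl₂ hl 0 1
  set σ : P3Ring →ₐ[ℂ] P3Ring := aeval fun i => X i - C (v i) * l₁ - C (w i) * l₂ with hσ
  have hlin : ∀ {l : P3Ring}, l.IsHomogeneous 1 →
      σ l = l - C (eval v l) * l₁ - C (eval w l) * l₂ := by
    intro l h
    refine isHomogeneous_one_induction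
      (P := fun l => σ l = l - C (eval v l) * l₁ - C (eval w l) * l₂) h (by simp)
      (fun i => by simp [hσ]) ?_ ?_
    · intro x y hx hy
      rw [map_add, hx, hy]
      simp only [map_add]
      ring
    · intro c x hx
      rw [map_smul, hx]
      simp only [smul_eq_C_mul, map_mul, eval_C]
      ring
  have hmod : ∀ x, σ x - x ∈ Ideal.span {l₁, l₂} := by
    intro x
    rw [← Ideal.Quotient.eq]
    have h : ((Ideal.Quotient.mkₐ ℂ (Ideal.span {l₁, l₂})).comp σ) =
        Ideal.Quotient.mkₐ ℂ (Ideal.span {l₁, l₂}) := by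
      refine MvPolynomial.algHom_ext fun i => ?_
      rw [AlgHom.comp_apply, hlin (isHomogeneous_X ℂ i)]
      refine Ideal.Quotient.eq.2 ?_
      rw [sub_sub (X i), sub_sub_cancel_left]
      exact neg_mem (Ideal.mem_span_pair.2 ⟨_, _, rfl⟩)
    exact DFunLike.congr_fun h x
  have hker : Ideal.span {l₁, l₂} = RingHom.ker σ := by
    refine le_antisymm (Ideal.span_le.2 ?_) fun x hx => ?_
    · rintro x (rfl | rfl)
      · change σ _ = 0
        rw [hlin hl₁, hv1, hw1]
        simp
      · change σ _ = 0
        rw [hlin hl₂, hv2, hw2]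
        simp
    · have h := hmod x
      rw [show σ x = 0 from hx, zero_sub] at h
      exact neg_mem_iff.1 h
  rw [hker]
  exact RingHom.ker_isPrime _

theorem not_dvd_of_linearIndependent (hl₁ : l₁.IsHomogeneous 1) (hl₂ : l₂.IsHomogeneous 1)
    (hl : LinearIndependent ℂ ![l₁, l₂]) : ¬ l₁ ∣ l₂ := by
  rintro ⟨c, hc⟩
  obtain ⟨w, hw1, hw2⟩ := exists_dual_vectors hl₁ hl₂ hl 0 1
  rw [hc, map_mul, hw1, zero_mul] at hw2
  exact zero_ne_one hw2

/-- The restriction of a polynomial to the affine line `u + s w`. -/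
theorem exists_polynomial_eval_line (A : P3Ring) (u w : Fin 4 → ℂ) :
    ∃ P : Polynomial ℂ, ∀ s, P.eval s = eval (u + s • w) A := by
  refine ⟨aeval (fun i => Polynomial.C (u i) + Polynomial.X * Polynomial.C (w i)) A, fun s => ?_⟩
  rw [← Polynomial.coe_evalRingHom, map_aeval, eval]
  congr 1
  ext
  · simp
  · simp
    ring

/-- A form of positive degree has a zero on the projective line through the points `u` and `w`. -/
theorem exists_zero_on_line {A : P3Ring} {m : ℕ} (hm : 0 < m) (hA : A.IsHomogeneous m)
    (u w : Fin 4 → ℂ) : eval u A = 0 ∨ ∃ s : ℂ, eval (w + s • u) A = 0 := by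
  by_contra! h
  obtain ⟨hu, hs⟩ := h
  obtain ⟨P, hP⟩ := exists_polynomial_eval_line A w u
  obtain ⟨Q, hQ⟩ := exists_polynomial_eval_line A u w
  have hdeg : P.degree = 0 := by
    by_contra hne
    obtain ⟨s, hroot⟩ := IsAlgClosed.exists_root P hne
    exact hs s (by rw [← hP]; exact hroot)
  rw [Polynomial.eq_C_of_degree_eq_zero hdeg] at hP
  simp only [Polynomial.eval_C] at hP
  -- By homogeneity `A (u + t w) = t ^ m A (w + t⁻¹ u) = c t ^ m` for `t ≠ 0`.
  have hzero : Q - Polynomial.C (P.coeff 0) * Polynomial.X ^ m = 0 := by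
    refine Polynomial.eq_zero_of_infinite_isRoot _
      ((Set.finite_singleton (0 : ℂ)).infinite_compl.mono fun t ht => ?_)
    have ht : t ≠ 0 := ht
    have h1 : u + t • w = t • (w + t⁻¹ • u) := by
      rw [smul_add, smul_smul, mul_inv_cancel₀ ht, one_smul, add_comm]
    change Polynomial.eval t _ = 0
    rw [Polynomial.eval_sub, hQ, h1, eval_smul_of_isHomogeneous hA, ← hP]
    simp
    ring
  have h0 := congrArg (Polynomial.eval 0) hzero
  rw [Polynomial.eval_sub, hQ] at h0
  apply hu
  simpa [hm.ne'] using h0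

variable {F : P3Ring} {d : ℕ}

/-- A smooth surface of degree at least two contains no plane: a reducible surface is singular
where its components meet. -/
theorem not_dvd_of_isSmoothSurface (hl₁ : l₁.IsHomogeneous 1) (hl₂ : l₂.IsHomogeneous 1)
    (hl : LinearIndependent ℂ ![l₁, l₂]) (hd : 2 ≤ d) (hX : IsSmoothSurface F d) : ¬ l₁ ∣ F := by
  rintro ⟨A, hA⟩
  obtain ⟨A, rfl, hAd⟩ : ∃ A, F = l₁ * A ∧ A.IsHomogeneous (d - 1) := by
    refine ⟨homogeneousComponent (d - 1) A, ?_, homogeneousComponent_isHomogeneous _ _⟩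
    rw [← homogeneousComponent_of_mem_self (k := d) hX.1, hA, mul_comm,
      homogeneousComponent_mul_of_mem hl₁, if_pos (by omega), mul_comm]
  have key : ∀ x, x ≠ 0 → eval x l₁ = 0 → eval x A = 0 → False := by
    intro x hx h1 h2
    obtain ⟨i, hi⟩ := hX.2 x hx (by rw [map_mul, h1, zero_mul])
    apply hi
    rw [pderiv_mul, map_add, map_mul, map_mul, h1, h2, mul_zero, zero_mul, add_zero]
  obtain ⟨u, hu0, hu1, hu2⟩ := exists_common_zero hl₁ hl₂
  obtain ⟨w, hw1, hw2⟩ := exists_dual_vectors hl₁ hl₂ hl 0 1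
  obtain ⟨f, hf⟩ := exists_linearMap_eval hl₁
  obtain ⟨g, hg⟩ := exists_linearMap_eval hl₂
  obtain h | ⟨s, h⟩ := exists_zero_on_line (by omega) hAd u w
  · exact key u hu0 hu1 h
  · refine key (w + s • u) ?_ (by rw [← hf, map_add, map_smul, hf, hf, hw1, hu1]; simp) h
    intro h0
    have h1 := hg (w + s • u)
    rw [map_add, map_smul, hg, hg, hw2, hu2, h0, ← hg, map_zero] at h1
    simp at h1

/-- If `A` and `B` both vanished on the line `l₁ = l₂ = 0`, then `F` would lie in the square of its
ideal and the surface would be singular along the line. -/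
theorem notMem_or_notMem_of_isSmoothSurface (hl₁ : l₁.IsHomogeneous 1) (hl₂ : l₂.IsHomogeneous 1)
    (hX : IsSmoothSurface F d) {G A B : P3Ring} (hF : F = l₁ * A + l₂ * G * B) :
    A ∉ Ideal.span {l₁, l₂} ∨ B ∉ Ideal.span {l₁, l₂} := by
  by_contra! h
  obtain ⟨u, hu0, hu1, hu2⟩ := exists_common_zero hl₁ hl₂
  have hz : ∀ x ∈ Ideal.span {l₁, l₂}, eval u x = 0 := by
    intro x hx
    obtain ⟨a, b, rfl⟩ := Ideal.mem_span_pair.1 hx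
    rw [map_add, map_mul, map_mul, hu1, hu2, mul_zero, mul_zero, add_zero]
  obtain ⟨i, hi⟩ := hX.2 u hu0 (by rw [hF]; simp [hu1, hu2])
  apply hi
  rw [hF]
  simp only [map_add, pderiv_mul, map_mul, hu1, hu2, hz A h.1, hz B h.2]
  ring

end LinearForms

/-! ### Regularity of the ideals of the two curves -/

section Regularity

theorem isHomogeneous_span_pair {x y : P3Ring} {b c : ℕ} (hx : x ∈ p3Grading b)
    (hy : y ∈ p3Grading c) : (Ideal.span {x, y}).IsHomogeneous p3Grading := by
  refine Ideal.homogeneous_span _ _ ?_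
  rintro z (rfl | rfl)
  · exact ⟨b, hx⟩
  · exact ⟨c, hy⟩

theorem isGradedPair_zero {K : Ideal P3Ring} (hK : K.IsHomogeneous p3Grading) :
    IsGradedPair 0 K :=
  ⟨⟨0, zero_mem _⟩, K.zero_mem, hK⟩

theorem isGradedPair_zero_top : IsGradedPair 0 ⊤ :=
  isGradedPair_zero (HomogeneousIdeal.isHomogeneous (⊤ : HomogeneousIdeal p3Grading))

variable {l : P3Ring}

/-- The ideal generated by a form `e` of degree `c` in the coordinate ring `S / (l)` of a plane is
`c`-regular, being a twist of `S / (l)`. -/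
theorem idealVanish_plane (hl : l.IsHomogeneous 1) (hlp : Prime l) {e : P3Ring} {c : ℕ}
    (he : e.IsHomogeneous c) (hle : ¬ l ∣ e) {n : ℤ} {i : ℕ} (h : i = 0 ∨ (c : ℤ) - 1 - i ≤ n) :
    IdealVanish l (Ideal.span {l, e}) n i := by
  have hlm : l ∈ Ideal.span {l, e} := Ideal.subset_span (by simp)
  have H : IdealSES 0 ⊤ l 0 ⊤ e l (Ideal.span {l, e}) :=
    { mul_mem_left := fun _ _ => Submodule.mem_top
      mul_mem_right := fun x _ => Ideal.mul_mem_right _ _ (Ideal.subset_span (by simp))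
      dvd_left := by simp
      dvd_right := by simp
      injective := fun x _ hx => by
        rw [zero_dvd_iff, mul_eq_zero] at hx
        exact zero_dvd_iff.2 (hx.resolve_left hlp.ne_zero)
      comp := fun x _ => Dvd.intro _ (by ring : l * (e * x) = e * (l * x))
      exact := fun x _ hx => by
        obtain ⟨y, rfl⟩ := (hlp.dvd_or_dvd hx).resolve_left hle
        exact ⟨y, Submodule.mem_top, by simp⟩
      surjective := fun y hy => by
        obtain ⟨u, v, rfl⟩ := Ideal.mem_span_pair.1 hy
        exact ⟨v, Submodule.mem_top, u, by ring⟩ }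
  by_cases hi : 3 ≤ i
  · exact cechVanish_of_three_le n hi
  refine H.idealVanish_right hl he isGradedPair_zero_top isGradedPair_zero_top
    ⟨⟨1, hl⟩, hlm, isHomogeneous_span_pair hl he⟩ (idealVanish_top (by omega)) ?_
  by_cases hi2 : i = 2
  · subst hi2
    exact cechVanish_of_three_le _ le_rfl
  · exact idealVanish_top (by push_cast; omega)

variable {l₁ l₂ : P3Ring}

/-- The ideal of a line is `1`-regular, and its `H¹` vanishes in every twist. -/
theorem idealVanish_line (hl₁ : l₁.IsHomogeneous 1) (hl₂ : l₂.IsHomogeneous 1) (hlp : Prime l₁)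
    (hl : ¬ l₁ ∣ l₂) {n : ℤ} {i : ℕ} (h : i = 0 ∨ -(i : ℤ) ≤ n) :
    IdealVanish 0 (Ideal.span {l₁, l₂}) n i := by
  have hI := isHomogeneous_span_pair hl₁ hl₂
  have hlm : l₁ ∈ Ideal.span {l₁, l₂} := Ideal.subset_span (by simp)
  have H : IdealSES 0 ⊤ l₁ 0 (Ideal.span {l₁, l₂}) 1 l₁ (Ideal.span {l₁, l₂}) :=
    { mul_mem_left := fun x _ => Ideal.mul_mem_right _ _ hlm
      mul_mem_right := fun x hx => by rwa [one_mul]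
      dvd_left := by simp
      dvd_right := by simp
      injective := fun x _ hx => by
        rw [zero_dvd_iff, mul_eq_zero] at hx
        exact zero_dvd_iff.2 (hx.resolve_left hlp.ne_zero)
      comp := fun x _ => by simp
      exact := fun x _ hx => by
        rw [one_mul] at hx
        obtain ⟨y, rfl⟩ := hx
        exact ⟨y, Submodule.mem_top, by simp⟩
      surjective := fun y hy => ⟨y, hy, by simp⟩ }
  by_cases hi : 3 ≤ i
  · exact cechVanish_of_three_le n hi
  refine H.idealVanish_middle hl₁ (isHomogeneous_one _ _) isGradedPair_zero_top
    (isGradedPair_zero hI) ⟨⟨1, hl₁⟩, hlm, hI⟩ (idealVanish_top (by push_cast; omega)) ?_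
  exact idealVanish_plane hl₁ hlp hl₂ hl (by push_cast; omega)

/-- The product of the ideals of the line and of the plane curve is `l₁ I + (l₂² G)`, where `I` is
the ideal of the line. -/
theorem mem_mul_span_pair_iff {G x : P3Ring} :
    x ∈ Ideal.span {l₁, l₂} * Ideal.span {l₁, l₂ * G} ↔
      ∃ u ∈ Ideal.span {l₁, l₂}, ∃ v, x = l₁ * u + l₂ * (l₂ * G) * v := by
  have hl₁ : l₁ ∈ Ideal.span {l₁, l₂} := Ideal.subset_span (by simp)
  have hl₂ : l₂ ∈ Ideal.span {l₁, l₂} := Ideal.subset_span (by simp)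
  constructor
  · intro hx
    have hle : Ideal.span {l₁, l₂} * Ideal.span {l₁, l₂ * G} ≤
        Ideal.span {l₁} * Ideal.span {l₁, l₂} ⊔ Ideal.span {l₂ * (l₂ * G)} := by
      have hm : ∀ u ∈ Ideal.span {l₁, l₂}, l₁ * u ∈
          Ideal.span {l₁} * Ideal.span {l₁, l₂} ⊔ Ideal.span {l₂ * (l₂ * G)} := fun u hu =>
        Ideal.mem_sup_left (Ideal.mem_span_singleton_mul.2 ⟨u, hu, rfl⟩)
      rw [Ideal.span_pair_mul_span_pair, Ideal.span_le]
      rintro z (rfl | rfl | rfl | rfl)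
      · exact hm _ hl₁
      · exact hm _ (Ideal.mul_mem_right _ _ hl₂)
      · rw [mul_comm l₂ l₁]
        exact hm _ hl₂
      · exact Ideal.mem_sup_right (Ideal.mem_span_singleton_self _)
    obtain ⟨y, hy, z, hz, rfl⟩ := Submodule.mem_sup.1 (hle hx)
    obtain ⟨u, hu, rfl⟩ := Ideal.mem_span_singleton_mul.1 hy
    obtain ⟨v, rfl⟩ := Ideal.mem_span_singleton.1 hz
    exact ⟨u, hu, v, rfl⟩
  · rintro ⟨u, hu, v, rfl⟩
    refine add_mem ?_ (Ideal.mul_mem_right _ _ (Ideal.mul_mem_mul hl₂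
      (Ideal.subset_span (by simp))))
    rw [mul_comm l₁ u]
    exact Ideal.mul_mem_mul hu (Ideal.subset_span (by simp))

theorem isHomogeneous_mul_span_pair (hl₁ : l₁.IsHomogeneous 1) (hl₂ : l₂.IsHomogeneous 1)
    {G : P3Ring} {a : ℕ} (hG : G.IsHomogeneous a) :
    (Ideal.span {l₁, l₂} * Ideal.span {l₁, l₂ * G}).IsHomogeneous p3Grading :=
  (isHomogeneous_span_pair hl₁ hl₂).mul (isHomogeneous_span_pair hl₁ (hl₂.mul hG))

/-- The product of the ideals of the line and of the plane curve is `(a + 2)`-regular, and its `H¹`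
vanishes in every twist. -/
theorem idealVanish_mul (hl₁ : l₁.IsHomogeneous 1) (hl₂ : l₂.IsHomogeneous 1) (hlp : Prime l₁)
    (hl : ¬ l₁ ∣ l₂) {G : P3Ring} {a : ℕ} (hG : G.IsHomogeneous a) (hlG : ¬ l₁ ∣ G) {n : ℤ} {i : ℕ}
    (h : i = 0 ∨ (a : ℤ) + 1 - i ≤ n) :
    IdealVanish 0 (Ideal.span {l₁, l₂} * Ideal.span {l₁, l₂ * G}) n i := by
  have he : (l₂ * (l₂ * G)).IsHomogeneous (1 + (1 + a)) := hl₂.mul (hl₂.mul hG)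
  have hle : ¬ l₁ ∣ l₂ * (l₂ * G) := fun h =>
    (hlp.dvd_or_dvd h).elim hl fun h => (hlp.dvd_or_dvd h).elim hl hlG
  have hlm : ∀ e : P3Ring, l₁ ∈ Ideal.span {l₁, e} := fun e => Ideal.subset_span (by simp)
  have H : IdealSES 0 (Ideal.span {l₁, l₂}) l₁ 0
      (Ideal.span {l₁, l₂} * Ideal.span {l₁, l₂ * G}) 1 l₁ (Ideal.span {l₁, l₂ * (l₂ * G)}) :=
    { mul_mem_left := fun x hx => mem_mul_span_pair_iff.2 ⟨x, hx, 0, by ring⟩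
      mul_mem_right := fun x hx => by
        obtain ⟨u, -, v, rfl⟩ := mem_mul_span_pair_iff.1 hx
        exact Ideal.mem_span_pair.2 ⟨u, v, by ring⟩
      dvd_left := by simp
      dvd_right := by simp
      injective := fun x _ hx => by
        rw [zero_dvd_iff, mul_eq_zero] at hx
        exact zero_dvd_iff.2 (hx.resolve_left hlp.ne_zero)
      comp := fun x _ => by simp
      exact := fun x hx hlx => by
        obtain ⟨u, hu, v, rfl⟩ := mem_mul_span_pair_iff.1 hx
        rw [one_mul, dvd_add_right (dvd_mul_right _ _)] at hlx
        obtain ⟨w, rfl⟩ := (hlp.dvd_or_dvd hlx).resolve_left hle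
        refine ⟨u + l₂ * (l₂ * G) * w, add_mem hu ?_, ⟨0, by ring⟩⟩
        exact Ideal.mul_mem_right _ _ (Ideal.mul_mem_right _ _ (Ideal.subset_span (by simp)))
      surjective := fun y hy => by
        obtain ⟨u, v, rfl⟩ := Ideal.mem_span_pair.1 hy
        exact ⟨l₂ * (l₂ * G) * v, mem_mul_span_pair_iff.2 ⟨0, zero_mem _, v, by ring⟩,
          u, by ring⟩ }
  refine H.idealVanish_middle hl₁ (isHomogeneous_one _ _)
    (isGradedPair_zero (isHomogeneous_span_pair hl₁ hl₂))
    (isGradedPair_zero (isHomogeneous_mul_span_pair hl₁ hl₂ hG))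
    ⟨⟨1, hl₁⟩, hlm _, isHomogeneous_span_pair hl₁ he⟩
    (idealVanish_line hl₁ hl₂ hlp hl (by push_cast; omega)) ?_
  exact idealVanish_plane hl₁ hlp he hle (by push_cast; omega)

/-- Let `F = l₁ A + l₂ G B` with `A` or `B` outside the prime ideal `I` of the line. A multiple of
`F` lies in `I J`, `J = (l₁, l₂ G)`, only if the multiplier lies in `I`: the classes of `l₁` and
`l₂ G` form a basis of `J / I J` over `S / I`. -/
theorem mem_of_mul_mem_mul_span_pair (hlp : Prime l₁) (hl : ¬ l₁ ∣ l₂)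
    (hI : (Ideal.span {l₁, l₂}).IsPrime) {F G A B : P3Ring} (hlG : ¬ l₁ ∣ G)
    (hF : F = l₁ * A + l₂ * G * B)
    (hAB : A ∉ Ideal.span {l₁, l₂} ∨ B ∉ Ideal.span {l₁, l₂}) {g : P3Ring}
    (hg : F * g ∈ Ideal.span {l₁, l₂} * Ideal.span {l₁, l₂ * G}) : g ∈ Ideal.span {l₁, l₂} := by
  have hle : ¬ l₁ ∣ l₂ * G := fun h => (hlp.dvd_or_dvd h).elim hl hlG
  obtain ⟨u, hu, v, huv⟩ := mem_mul_span_pair_iff.1 hg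
  obtain ⟨t, ht⟩ : l₁ ∣ l₂ * v - B * g := by
    refine (hlp.dvd_or_dvd (b := l₂ * v - B * g) (a := l₂ * G) ?_).resolve_left hle
    exact ⟨A * g - u, by rw [hF] at huv; linear_combination (-1 : P3Ring) * huv⟩
  have hBg : B * g ∈ Ideal.span {l₁, l₂} :=
    Ideal.mem_span_pair.2 ⟨-t, v, by linear_combination ht⟩
  have hAg : A * g ∈ Ideal.span {l₁, l₂} := by
    have h1 : A * g = u + l₂ * (G * t) := by
      apply mul_left_cancel₀ hlp.ne_zero
      rw [hF] at huv
      linear_combination huv + l₂ * G * ht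
    rw [h1]
    exact add_mem hu (Ideal.mul_mem_right _ _ (Ideal.subset_span (by simp)))
  rcases hAB with hA | hB
  · exact (hI.mem_or_mem hAg).resolve_left hA
  · exact (hI.mem_or_mem hBg).resolve_left hB

theorem isGradedPair_sup {F : P3Ring} {d : ℕ} (hF : F.IsHomogeneous d) {K : Ideal P3Ring}
    (hK : K.IsHomogeneous p3Grading) : IsGradedPair F (K ⊔ Ideal.span {F}) :=
  ⟨⟨d, hF⟩, Ideal.mem_sup_right (Ideal.mem_span_singleton_self F),
    hK.sup (Ideal.homogeneous_span _ _ (by rintro z rfl; exact ⟨d, hF⟩))⟩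

theorem divisorSumModule_eq (F : P3Ring) (I J : Ideal P3Ring) :
    divisorSumModule F I J = idealModule F (I * J ⊔ Ideal.span {F}) := by
  rw [divisorSumModule, idealModule, Ideal.map_sup, Ideal.map_mul, Ideal.map_quotient_self,
    sup_bot_eq]

/-- The case `d ≥ a + 2`, where `0 → I(-d) → I J → 𝒪_X(-l-C₀) → 0` reduces the claim to the
regularity of `I` and of `I J`. -/
theorem idealVanish_of_le (hl₁ : l₁.IsHomogeneous 1) (hl₂ : l₂.IsHomogeneous 1) (hlp : Prime l₁)
    (hl : ¬ l₁ ∣ l₂) (hI : (Ideal.span {l₁, l₂}).IsPrime) {F G A B : P3Ring} {a d : ℕ}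
    (hG : G.IsHomogeneous a) (hlG : ¬ l₁ ∣ G) (hFd : F.IsHomogeneous d)
    (hF : F = l₁ * A + l₂ * G * B) (hF0 : F ≠ 0)
    (hAB : A ∉ Ideal.span {l₁, l₂} ∨ B ∉ Ideal.span {l₁, l₂}) (had : a + 2 ≤ d) (i : ℕ) :
    IdealVanish F (Ideal.span {l₁, l₂} * Ideal.span {l₁, l₂ * G} ⊔ Ideal.span {F})
      (d - (i + 1)) i := by
  have hFJ : F ∈ Ideal.span {l₁, l₂ * G} := Ideal.mem_span_pair.2 ⟨A, B, by rw [hF]; ring⟩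
  have H : IdealSES 0 (Ideal.span {l₁, l₂}) F 0
      (Ideal.span {l₁, l₂} * Ideal.span {l₁, l₂ * G}) 1 F
      (Ideal.span {l₁, l₂} * Ideal.span {l₁, l₂ * G} ⊔ Ideal.span {F}) :=
    { mul_mem_left := fun x hx => by
        rw [mul_comm F x]
        exact Ideal.mul_mem_mul hx hFJ
      mul_mem_right := fun x hx => by
        rw [one_mul]
        exact Ideal.mem_sup_left hx
      dvd_left := by simp
      dvd_right := by simp
      injective := fun x _ hx => by
        rw [zero_dvd_iff, mul_eq_zero] at hx
        exact zero_dvd_iff.2 (hx.resolve_left hF0)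
      comp := fun x _ => by simp
      exact := fun x hx hFx => by
        rw [one_mul] at hFx
        obtain ⟨g, rfl⟩ := hFx
        exact ⟨g, mem_of_mul_mem_mul_span_pair hlp hl hI hlG hF hAB hx, by simp⟩
      surjective := fun y hy => by
        obtain ⟨x, hx, z, hz, rfl⟩ := Submodule.mem_sup.1 hy
        exact ⟨x, hx, by simpa using Ideal.mem_span_singleton.1 hz⟩ }
  refine H.idealVanish_right hFd (isHomogeneous_one _ _)
    (isGradedPair_zero (isHomogeneous_span_pair hl₁ hl₂))
    (isGradedPair_zero (isHomogeneous_mul_span_pair hl₁ hl₂ hG))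
    (isGradedPair_sup hFd (isHomogeneous_mul_span_pair hl₁ hl₂ hG))
    (idealVanish_mul hl₁ hl₂ hlp hl hG hlG (by push_cast; omega))
    (idealVanish_line hl₁ hl₂ hlp hl (by push_cast; omega))

/-- The case `d = a + 1`: then `C₀` is the section of the surface by the plane `l₁ = 0`, so that
`𝒪_X(-l-C₀) = 𝒪_X(-l)(-1)`. -/
theorem idealVanish_of_planeSection (hl₁ : l₁.IsHomogeneous 1) (hl₂ : l₂.IsHomogeneous 1)
    (hlp : Prime l₁) (hl : ¬ l₁ ∣ l₂) {F G A : P3Ring} {a d : ℕ} {b : ℂ}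
    (hG : G.IsHomogeneous a) (hFd : F.IsHomogeneous d) (hF : F = l₁ * A + l₂ * G * C b)
    (hb : b ≠ 0) (hlF : ¬ l₁ ∣ F) (hd : 2 ≤ d) (i : ℕ) :
    IdealVanish F (Ideal.span {l₁, l₂} * Ideal.span {l₁, l₂ * G} ⊔ Ideal.span {F})
      (d - (i + 1)) i := by
  have hbb : (C b⁻¹ : P3Ring) * C b = 1 := by rw [← C_mul, inv_mul_cancel₀ hb, C_1]
  have hl₁I : l₁ ∈ Ideal.span {l₁, l₂} := Ideal.subset_span (by simp)
  have hl₂I : l₂ ∈ Ideal.span {l₁, l₂} := Ideal.subset_span (by simp)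
  have hFI : F ∈ Ideal.span {l₁, l₂} :=
    Ideal.mem_span_pair.2 ⟨A, G * C b, by rw [hF]; ring⟩
  have hF0 : F ≠ 0 := by
    rintro rfl
    exact hlF (dvd_zero _)
  have H : IdealSES 0 ⊤ F 0 (Ideal.span {l₁, l₂}) l₁ F
      (Ideal.span {l₁, l₂} * Ideal.span {l₁, l₂ * G} ⊔ Ideal.span {F}) :=
    { mul_mem_left := fun x _ => Ideal.mul_mem_right _ _ hFI
      mul_mem_right := fun x hx =>
        Ideal.mem_sup_left (mem_mul_span_pair_iff.2 ⟨x, hx, 0, by ring⟩)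
      dvd_left := by simp
      dvd_right := by simp
      injective := fun x _ hx => by
        rw [zero_dvd_iff, mul_eq_zero] at hx
        exact zero_dvd_iff.2 (hx.resolve_left hF0)
      comp := fun x _ => ⟨l₁ * x, by ring⟩
      exact := fun x _ hFx => by
        obtain ⟨w, hw⟩ := hFx
        obtain ⟨y, rfl⟩ := (hlp.dvd_or_dvd (Dvd.intro _ hw)).resolve_left hlF
        refine ⟨y, Submodule.mem_top, 0, ?_⟩
        apply mul_left_cancel₀ hlp.ne_zero
        linear_combination hw
      surjective := fun y hy => by
        obtain ⟨x, hx, z, hz, rfl⟩ := Submodule.mem_sup.1 hy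
        obtain ⟨c, rfl⟩ := Ideal.mem_span_singleton.1 hz
        obtain ⟨u, hu, v, rfl⟩ := mem_mul_span_pair_iff.1 hx
        -- Modulo `F`, the form `l₂ G` equals `-b⁻¹ l₁ A`.
        refine ⟨u - l₂ * (A * v * C b⁻¹), sub_mem hu (Ideal.mul_mem_right _ _ hl₂I),
          c + C b⁻¹ * l₂ * v, ?_⟩
        rw [hF]
        linear_combination (-(l₂ * (l₂ * G) * v)) * hbb }
  refine H.idealVanish_right hFd hl₁ isGradedPair_zero_top
    (isGradedPair_zero (isHomogeneous_span_pair hl₁ hl₂))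
    (isGradedPair_sup hFd (isHomogeneous_mul_span_pair hl₁ hl₂ hG))
    (idealVanish_line hl₁ hl₂ hlp hl (by push_cast; omega)) ?_
  by_cases hi : 3 ≤ i + 1
  · exact cechVanish_of_three_le _ hi
  · exact idealVanish_top (by push_cast; omega)

end Regularity

end

theorem mainTheorem10 (a d : ℕ) (ha : 0 < a) (hd : 2 ≤ d)
    (l₁ l₂ G₁ F : P3Ring)
    (hl₁ : l₁.IsHomogeneous 1) (hl₂ : l₂.IsHomogeneous 1)
    (hl : LinearIndependent ℂ ![l₁, l₂])
    (hG₁ : G₁.IsHomogeneous a) (hl₁G₁ : ¬ l₁ ∣ G₁)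
    (hX : IsSmoothSurface F d)
    (hC₀X : F ∈ Ideal.span {l₁, l₂ * G₁}) :
    IsCMRegular (inducedGrading F
      (divisorSumModule F (Ideal.span {l₁, l₂}) (Ideal.span {l₁, l₂ * G₁}))) (d : ℤ) := by
  have hlp : Prime l₁ := prime_of_isHomogeneous_one hl₁ (by simpa using hl.ne_zero 0)
  have hll : ¬ l₁ ∣ l₂ := not_dvd_of_linearIndependent hl₁ hl₂ hl
  have hlF : ¬ l₁ ∣ F := not_dvd_of_isSmoothSurface hl₁ hl₂ hl hd hX
  obtain ⟨A, B, hAB⟩ := Ideal.mem_span_pair.1 hC₀X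
  have hF : F = l₁ * A + l₂ * G₁ * B := by rw [← hAB]; ring
  -- The degree `d` part of the relation `F = l₁ A + l₂ G₁ B`.
  have hcomp : F = homogeneousComponent (d - 1) A * l₁ +
      if 1 + a ≤ d then homogeneousComponent (d - (1 + a)) B * (l₂ * G₁) else 0 := by
    have h := homogeneousComponent_of_mem_self (k := d) hX.1
    rw [← hAB, map_add, homogeneousComponent_mul_of_mem hl₁, if_pos (by omega),
      homogeneousComponent_mul_of_mem (hl₂.mul hG₁), hAB] at h
    exact h.symm
  have had : 1 + a ≤ d := by
    by_contra hlt
    rw [if_neg hlt, add_zero] at hcomp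
    exact hlF (Dvd.intro_left _ hcomp.symm)
  intro i
  rw [divisorSumModule_eq]
  refine CechVanish.subsingleton ?_
  rcases had.eq_or_lt with rfl | hlt
  · rw [if_pos le_rfl, Nat.sub_self, homogeneousComponent_zero] at hcomp
    have hb : coeff 0 B ≠ 0 := by
      intro h0
      rw [h0, C_0, zero_mul, add_zero] at hcomp
      exact hlF (Dvd.intro_left _ hcomp.symm)
    exact idealVanish_of_planeSection hl₁ hl₂ hlp hll hG₁ hX.1 (hcomp.trans (by ring)) hb hlF hd i
  · have hF0 : F ≠ 0 := fun h => hlF (h ▸ dvd_zero _)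
    exact idealVanish_of_le hl₁ hl₂ hlp hll (isPrime_span_pair hl₁ hl₂ hl) hG₁ hl₁G₁ hX.1 hF hF0
      (notMem_or_notMem_of_isSmoothSurface hl₁ hl₂ hX hF) (by omega) i
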